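/- Let $K$ be a field of characteristic zero and $W=\langle e,f\rangle$ the $\mathbb Z_2$-graded $K$-vector space with basis $e$ (even) and $f$ (odd). Let $S(W)=\bigoplus_{k\ge1}S^k(W)$ be its reduced symmetric coalgebra, so that $S^k(W)=\langle e^k,e^{k-1}f\rangle$, with coproduct $$\Delta(w_1\cdots w_n)=\sum_{k=1}^{n-1}\sum_{\sigma\in\mathrm{Sh}(k,n-k)}\epsilon(\sigma)\,w_{\sigma(1)}\cdots w_{\sigma(k)}\otimes w_{\sigma(k+1)}\cdots w_{\sigma(n)},$$ where $\mathrm{Sh}(k,n-k)$ is the set of unshuffles and $w_{\sigma(1)}\cdots w_{\sigma(n)}=\epsilon(\sigma)w_1\cdots w_n$. An $L_\infty$ structure on $W$ is an odd coderivation $d$ of $S(W)$ with $d^2=0$. Two $L_\infty$ structures $d,d'$ are equivalent if $d'=g^{-1}\circ d\circ g$ for some (even) coalgebra automorphism $g$ of $S(W)$. A linear map $\varphi:S(W)\to W$ is identified with the coderivation $$w_1\cdots w_n\mapsto\sum_{k=1}^{n}\sum_{\sigma\in\mathrm{Sh}(k,n-k)}\epsilon(\sigma)\,\varphi(w_{\sigma(1)}\cdots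 w_{\sigma(k)})\,w_{\sigma(k+1)}\cdots w_{\sigma(n)}.$$ For $k\ge1$ let $\psi^k_e,\psi^k_f:S(W)\to W$ be the maps that vanish on $S^n(W)$ for $n\neq k$ and satisfy $$\psi^k_e(e^{k-1}f)=(k-1)!\,e,\quad \psi^k_e(e^k)=0,\qquad \psi^k_f(e^k)=k!\,f,\quad \psi^k_f(e^{k-1}f)=0.$$ Say that a nonzero coderivation is of $e$-type if it has the form $\sum_{k\ge1}r_k\psi^k_e$, and of $f$-type if it has the form $\sum_{k\ge1}s_k\psi^k_f$, with $r_k,s_k\in K$ (possibly infinitely many of them nonzero). Then: 1. For every $L\ge1$, $\psi^L_e$ and $\psi^L_f$ are nonzero $L_\infty$ structures (of $e$-type and $f$-type respectively). 2. Every nonzero $L_\infty$ structure on $W$ is either of $e$-type and equivalent to $\psi^L_e$ for some $L\ge1$, or of $f$-type and equivalent to $\psi^L_f$ for some $L\ge1$. 3. An $L_\infty$ structure of $e$-type is never equivalent to one of $f$-type. 4. If $k\ne l$, then $\psi^k_e$ and $\psi^l_e$ are not equivalent, and $\psi^k_f$ and $\psi^l_f$ are not equivalent. Thus there are two infinite families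 of pairwise nonequivalent $L_\infty$ structures. 5. For $L\ge1$, each of $\psi^L_e$ and $\psi^L_f$ is a Lie algebra structure if and only if $L=2$. Here a codifferential is called a Lie algebra structure if it is given by some $\varphi\in\mathrm{Hom}(S^2(W),W)$ such that, on the parity reversion $V=\Pi W$, the bilinear bracket determined by $\varphi(ab)=(-1)^{|a|}[a,b]$ ($|a|$ the parity of $a$ in $V$) makes $V$ a $\mathbb Z_2$-graded Lie algebra (Lie superalgebra). -/

import Mathlib

open scoped TensorProduct

namespace SuperPlane

/-- The homogeneous basis of the `1|1`-dimensional space `W = ⟨e, f⟩`. -/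
inductive Gen : Type
  | e : Gen
  | f : Gen

/-- `e` is even and `f` is odd. -/
def Gen.parity : Gen → ZMod 2
  | Gen.e => 0
  | Gen.f => 1

/-- The vector space `W = ⟨e, f⟩` over `K`. -/
abbrev W (K : Type*) [Field K] : Type _ := Gen →₀ K

/-- The monomial basis of the reduced symmetric algebra `S(W)` (no unit):
`Mono.pow n` is `e ^ (n + 1)` and `Mono.powF n` is `e ^ n f`. -/
inductive Mono : Type
  | pow : ℕ → Mono
  | powF : ℕ → Mono

/-- The parity of a monomial. -/
def Mono.parity : Mono → ZMod 2
  | Mono.pow _ => 0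
  | Mono.powF _ => 1

/-- The degree of a monomial: `S^k(W) = ⟨e ^ k, e ^ (k - 1) f⟩`. -/
def Mono.degree : Mono → ℕ
  | Mono.pow n => n + 1
  | Mono.powF n => n + 1

/-- A monomial written as a word in `e` and `f`. -/
def Mono.word : Mono → List Gen
  | Mono.pow n => List.replicate (n + 1) Gen.e
  | Mono.powF n => List.replicate n Gen.e ++ [Gen.f]

/-- The reduced symmetric algebra `S(W) = ⨁_{k ≥ 1} S^k(W)`. -/
abbrev S (K : Type*) [Field K] : Type _ := Mono →₀ K

/-- The sign `(-1) ^ (p q)` of the interchange of elements of parities `p` and `q`. -/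
def koszul (p q : ZMod 2) : ℤ := if p = 1 ∧ q = 1 then -1 else 1

/-- The parity of a word. -/
def wordParity (w : List Gen) : ZMod 2 := (w.map Gen.parity).sum

/-- Left multiplication of monomials by a generator: `e e^n = e^(n+1)`, `f e^n = e^n f`,
`e (e^n f) = e^(n+1) f` and `f (e^n f) = 0` (as `f f = - f f`). -/
noncomputable def genMul (K : Type*) [Field K] : Gen → Mono → S K
  | Gen.e, Mono.pow n => Finsupp.single (Mono.pow (n + 1)) 1
  | Gen.e, Mono.powF n => Finsupp.single (Mono.powF (n + 1)) 1
  | Gen.f, Mono.pow n => Finsupp.single (Mono.powF (n + 1)) 1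
  | Gen.f, Mono.powF _ => 0

/-- The product `w_1 ⋯ w_n` in `S(W)` of a word in the generators. The empty word, which has no
counterpart in the reduced algebra, is sent to `0`. -/
noncomputable def wordProd (K : Type*) [Field K] : List Gen → S K
  | [] => 0
  | [Gen.e] => Finsupp.single (Mono.pow 0) 1
  | [Gen.f] => Finsupp.single (Mono.powF 0) 1
  | a :: b :: w => Finsupp.lift (S K) K Mono (genMul K a) (wordProd K (b :: w))

/-- All unshuffles of a word `w`: the list of the triples `(ε, u, v)`, where `u` and `v` are
complementary subwords of `w` (possibly empty) and `ε` is the sign with `u v = ε w` in the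
graded commutative algebra. -/
def unshuffles : List Gen → List (ℤ × List Gen × List Gen)
  | [] => [(1, [], [])]
  | a :: w =>
      (unshuffles w).map (fun t => (t.1, a :: t.2.1, t.2.2)) ++
      (unshuffles w).map
        (fun t => (koszul a.parity (wordParity t.2.1) * t.1, t.2.1, a :: t.2.2))

/-- The coproduct of `S(W)`,
`Δ (w_1 ⋯ w_n) = ∑_{0 < k < n} ∑_{σ ∈ Sh(k, n-k)} ε(σ)
  w_{σ(1)} ⋯ w_{σ(k)} ⊗ w_{σ(k+1)} ⋯ w_{σ(n)}`;
the terms `k = 0` and `k = n` vanish since the empty word is sent to `0`. -/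
noncomputable def coprod (K : Type*) [Field K] : S K →ₗ[K] S K ⊗[K] S K :=
  Finsupp.lift (S K ⊗[K] S K) K Mono fun m =>
    ((unshuffles m.word).map fun t => t.1 • (wordProd K t.2.1 ⊗ₜ[K] wordProd K t.2.2)).sum

/-- The endomorphism `T` of `S(W)` is homogeneous of parity `p`. -/
def HasParity {K : Type*} [Field K] (p : ZMod 2) (T : S K →ₗ[K] S K) : Prop :=
  ∀ m m' : Mono, T (Finsupp.single m 1) m' ≠ 0 → m'.parity = m.parity + p

/-- The grading involution `x ↦ (-1) ^ |x| x` of `S(W)`. -/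
noncomputable def gradingInv (K : Type*) [Field K] : S K →ₗ[K] S K :=
  Finsupp.lift (S K) K Mono fun m => koszul 1 m.parity • Finsupp.single m 1

/-- `δ` is an odd coderivation: `δ` is odd and `Δ ∘ δ = (δ ⊗ I + I ⊗ δ) ∘ Δ`, where, by the
sign rule, `(I ⊗ δ) (x ⊗ y) = (-1) ^ |x| x ⊗ δ y`. -/
def IsOddCoderivation {K : Type*} [Field K] (δ : S K →ₗ[K] S K) : Prop :=
  HasParity 1 δ ∧
    coprod K ∘ₗ δ =
      (TensorProduct.map δ LinearMap.id + TensorProduct.map (gradingInv K) δ) ∘ₗ coprod K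

/-- An `L_∞` structure on `W`: an odd coderivation of `S(W)` with square zero. -/
def IsLInfty {K : Type*} [Field K] (d : S K →ₗ[K] S K) : Prop :=
  IsOddCoderivation d ∧ d ∘ₗ d = 0

/-- `g` is an automorphism of the graded coalgebra `S(W)`. -/
def IsCoalgAut {K : Type*} [Field K] (g : S K ≃ₗ[K] S K) : Prop :=
  HasParity 0 g.toLinearMap ∧
    coprod K ∘ₗ g.toLinearMap = TensorProduct.map g.toLinearMap g.toLinearMap ∘ₗ coprod K

/-- `d` and `d'` are equivalent: `d' = g⁻¹ ∘ d ∘ g` for a coalgebra automorphism `g`. -/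
def Equivalent {K : Type*} [Field K] (d d' : S K →ₗ[K] S K) : Prop :=
  ∃ g : S K ≃ₗ[K] S K, IsCoalgAut g ∧ d' = g.symm.toLinearMap ∘ₗ d ∘ₗ g.toLinearMap

/-- The coderivation `φ~` of `S(W)` associated with `φ ∈ Hom(S(W), W)`,
`φ~ (w_1 ⋯ w_n) = ∑_{k ≥ 1} ∑_{σ ∈ Sh(k, n-k)} ε(σ)
  φ (w_{σ(1)} ⋯ w_{σ(k)}) w_{σ(k+1)} ⋯ w_{σ(n)}`. -/
noncomputable def coder {K : Type*} [Field K] (φ : S K →ₗ[K] W K) : S K →ₗ[K] S K :=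
  Finsupp.lift (S K) K Mono fun m =>
    ((unshuffles m.word).map fun t =>
      t.1 • Finsupp.lift (S K) K Gen (fun a => wordProd K (a :: t.2.2))
        (φ (wordProd K t.2.1))).sum

/-- `ψ^k_e ∈ Hom(S^k(W), W)`: `e ^ (k - 1) f ↦ (k - 1)! e` and `e ^ k ↦ 0`. -/
noncomputable def psiE (K : Type*) [Field K] (k : ℕ) : S K →ₗ[K] W K :=
  Finsupp.lift (W K) K Mono fun m =>
    match m with
    | Mono.pow _ => 0
    | Mono.powF n => if n + 1 = k then Finsupp.single Gen.e ((k - 1).factorial : K) else 0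

/-- `ψ^k_f ∈ Hom(S^k(W), W)`: `e ^ k ↦ k! f` and `e ^ (k - 1) f ↦ 0`. -/
noncomputable def psiF (K : Type*) [Field K] (k : ℕ) : S K →ₗ[K] W K :=
  Finsupp.lift (W K) K Mono fun m =>
    match m with
    | Mono.pow n => if n + 1 = k then Finsupp.single Gen.f (k.factorial : K) else 0
    | Mono.powF _ => 0

/-- The element of `Hom(S(W), W) = ∏_k Hom(S^k(W), W)` given by the series `∑_k r_k ψ^k`. -/
noncomputable def series {K : Type*} [Field K] (ψ : ℕ → S K →ₗ[K] W K) (r : ℕ → K) :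
    S K →ₗ[K] W K :=
  Finsupp.lift (W K) K Mono fun m => r m.degree • ψ m.degree (Finsupp.single m 1)

/-- `d` is nonzero and of the form `∑_k r_k ψ^k_e`. -/
def IsEType {K : Type*} [Field K] (d : S K →ₗ[K] S K) : Prop :=
  d ≠ 0 ∧ ∃ r : ℕ → K, d = coder (series (psiE K) r)

/-- `d` is nonzero and of the form `∑_k s_k ψ^k_f`. -/
def IsFType {K : Type*} [Field K] (d : S K →ₗ[K] S K) : Prop :=
  d ≠ 0 ∧ ∃ s : ℕ → K, d = coder (series (psiF K) s)

/-- The parity of a generator in the parity reversion `ΠW`: `e` is odd and `f` is even. -/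
def Gen.revParity (a : Gen) : ZMod 2 := a.parity + 1

/-- The homogeneous component of parity `p` of the parity reversion `ΠW` (which has the same
underlying vector space as `W`). -/
def revComponent (K : Type*) [Field K] (p : ZMod 2) : Submodule K (W K) :=
  Finsupp.supported K K {a : Gen | a.revParity = p}

/-- `B` is the bracket of a `ℤ/2`-graded Lie algebra (Lie superalgebra) on `ΠW`: it is even,
graded antisymmetric, and satisfies the graded Jacobi identity. -/
def IsSuperLieBracket {K : Type*} [Field K] (B : W K →ₗ[K] W K →ₗ[K] W K) : Prop :=
  (∀ p q : ZMod 2, ∀ x ∈ revComponent K p, ∀ y ∈ revComponent K q,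
    B x y ∈ revComponent K (p + q)) ∧
  (∀ p q : ZMod 2, ∀ x ∈ revComponent K p, ∀ y ∈ revComponent K q,
    B x y = -(koszul p q • B y x)) ∧
  (∀ p q : ZMod 2, ∀ x ∈ revComponent K p, ∀ y ∈ revComponent K q, ∀ z : W K,
    B x (B y z) = B (B x y) z + koszul p q • B y (B x z))

/-- The codifferential `d` is a (`ℤ/2`-graded) Lie algebra structure on `ΠW`: it comes from an
element `φ` of `Hom(S^2(W), W)` and, up to the sign of the identification of `S^2(W)` with
`⋀^2(ΠW)`, `φ` is a Lie bracket: `φ (a b) = (-1) ^ |a| [a, b]`, with `|a|` the parity in `ΠW`. -/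
def IsLieStructure {K : Type*} [Field K] (d : S K →ₗ[K] S K) : Prop :=
  ∃ φ : S K →ₗ[K] W K, d = coder φ ∧
    (∀ m : Mono, m.degree ≠ 2 → φ (Finsupp.single m 1) = 0) ∧
    ∃ B : W K →ₗ[K] W K →ₗ[K] W K, IsSuperLieBracket B ∧
      ∀ a b : Gen, φ (wordProd K [a, b]) =
        koszul 1 a.revParity • B (Finsupp.single a 1) (Finsupp.single b 1)

end SuperPlane

open scoped PowerSeries
open Finset.HasAntidiagonal (antidiagonal)

namespace SuperPlane

/-! The full dual of `S(W)` is the augmentation ideal of `K⟦t⟧[θ]`, with `t` even dual to `e` and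
`θ` odd dual to `f`. Odd coderivations are dual to vector fields `r(t) θ ∂_t + s(t) ∂_θ` with `s(0)
= 0`. Everything is carried out on the coalgebra side: in the sequences `e^n/n!` and `e^n f/n!` the
coproduct becomes a convolution, power series act on sequences by `conv`, and `ActsBy d r s` records
the pair attached to `d`.

Every odd coderivation has such a pair (`IsOddCoderivation.exists_actsBy`): contracting the
coproduct with `t` lowers degree and has kernel `W`, so an induction recovers `d` from its
`W`-component. The square of `d` sends the sequence `e^n/n!` to `s r` times `e^{n+1}/n!`. As `K⟦t⟧`
is a domain, `d² = 0` forces `r = 0` or `s = 0`, which are the two types. Writing the surviving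
series as `t^k` times a unit `u`, the substitution `θ ↦ u^{±1} θ` removes the unit and leaves a
model `ψ^L`.

For nonequivalence, automorphisms commute with the grading involution `J`. The types are separated
by `d J = -d` against `d J = d`, and the members of a family by the dimension of the kernel of `d`
on the parity component that `d` does not kill. Finally `φ` can be read off from its coderivation,
so only `L = 2` can be quadratic, and there the brackets are explicit. -/

section

/-! ### Unshuffles of the words `e^n` and `e^n f` -/

section Unshuffles

theorem koszul_zero_left (q : ZMod 2) : koszul 0 q = 1 := by
  simp [koszul]

theorem koszul_zero_right (p : ZMod 2) : koszul p 0 = 1 := by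
  simp [koszul]

/-- All signs are `1` since `e` is even, and only the length of a subword matters; the recursion on
the first letter is Pascal's rule. -/
theorem sum_unshuffles_replicate {M : Type*} [AddCommMonoid M] (n : ℕ)
    (F : ℤ × List Gen × List Gen → M) :
    ((unshuffles (List.replicate n Gen.e)).map F).sum =
      ∑ p ∈ antidiagonal n,
        n.choose p.1 • F (1, List.replicate p.1 Gen.e, List.replicate p.2 Gen.e) := by
  induction n generalizing F with
  | zero => simp [unshuffles]
  | succ n ih =>
    rw [Finset.sum_antidiagonal_choose_succ_nsmul
      (fun i j => F (1, List.replicate i Gen.e, List.replicate j Gen.e))]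
    simp only [List.replicate_succ, unshuffles, List.map_append, List.map_map, List.sum_append, ih,
      Function.comp_def, Gen.parity, koszul_zero_left, mul_one]
    rw [add_comm]
    congr 1
    refine Finset.sum_congr rfl fun p hp => ?_
    rw [Nat.choose_symm_of_eq_add (Finset.HasAntidiagonal.mem_antidiagonal.1 hp).symm]

/-- The only odd letter is the last one, and it passes only even letters, so no sign appears; it
ends up in either of the two subwords. -/
theorem sum_unshuffles_replicate_append {M : Type*} [AddCommMonoid M] (n : ℕ)
    (F : ℤ × List Gen × List Gen → M) :
    ((unshuffles (List.replicate n Gen.e ++ [Gen.f])).map F).sum =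
      ∑ p ∈ antidiagonal n, n.choose p.1 •
        (F (1, List.replicate p.1 Gen.e ++ [Gen.f], List.replicate p.2 Gen.e) +
          F (1, List.replicate p.1 Gen.e, List.replicate p.2 Gen.e ++ [Gen.f])) := by
  induction n generalizing F with
  | zero => simp [unshuffles, wordParity, koszul_zero_right]
  | succ n ih =>
    rw [Finset.sum_antidiagonal_choose_succ_nsmul
      (fun i j => F (1, List.replicate i Gen.e ++ [Gen.f], List.replicate j Gen.e) +
        F (1, List.replicate i Gen.e, List.replicate j Gen.e ++ [Gen.f]))]
    simp only [List.replicate_succ, List.cons_append, unshuffles, List.map_append, List.map_map,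
      List.sum_append, ih, Function.comp_def, Gen.parity, koszul_zero_left, mul_one]
    rw [add_comm]
    congr 1
    refine Finset.sum_congr rfl fun p hp => ?_
    rw [Nat.choose_symm_of_eq_add (Finset.HasAntidiagonal.mem_antidiagonal.1 hp).symm]

end Unshuffles

variable {K : Type*} [Field K]

/-! ### Divided powers -/

/-- The divided power `e ^ n / n!`, with the convention that it vanishes for `n = 0`. -/
noncomputable def divPow (K : Type*) [Field K] : ℕ → S K
  | 0 => 0
  | n + 1 => Finsupp.single (Mono.pow n) ((n + 1).factorial : K)⁻¹

/-- The element `e ^ n f / n!`. -/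
noncomputable def divPowF (K : Type*) [Field K] (n : ℕ) : S K :=
  Finsupp.single (Mono.powF n) (n.factorial : K)⁻¹

/-- The element `e ^ (n + 1) / n!`. -/
noncomputable def eDivPow (K : Type*) [Field K] (n : ℕ) : S K :=
  Finsupp.single (Mono.pow n) (n.factorial : K)⁻¹

theorem divPow_zero : divPow K 0 = 0 := rfl

section CharZero

variable [CharZero K]

theorem eDivPow_eq (n : ℕ) : eDivPow K n = ((n : K) + 1) • divPow K (n + 1) := by
  have h : ((n : K) + 1) ≠ 0 := by exact_mod_cast n.succ_ne_zero
  have h' : (n.factorial : K) ≠ 0 := by exact_mod_cast n.factorial_ne_zero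
  simp only [eDivPow, divPow, Finsupp.smul_single, Nat.factorial_succ, Nat.cast_mul, smul_eq_mul]
  congr 1
  push_cast
  field_simp

theorem single_pow (n : ℕ) :
    Finsupp.single (Mono.pow n) (1 : K) = ((n + 1).factorial : K) • divPow K (n + 1) := by
  have h' : ((n + 1).factorial : K) ≠ 0 := by exact_mod_cast (n + 1).factorial_ne_zero
  simp [divPow, h']

theorem single_pow' (n : ℕ) :
    Finsupp.single (Mono.pow n) (1 : K) = (n.factorial : K) • eDivPow K n := by
  have h' : (n.factorial : K) ≠ 0 := by exact_mod_cast n.factorial_ne_zero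
  simp [eDivPow, h']

theorem single_powF (n : ℕ) :
    Finsupp.single (Mono.powF n) (1 : K) = (n.factorial : K) • divPowF K n := by
  have h' : (n.factorial : K) ≠ 0 := by exact_mod_cast n.factorial_ne_zero
  simp [divPowF, h']

/-- Factorials are invertible in characteristic zero, so the two sequences span `S(W)`. -/
theorem hom_ext {M : Type*} [AddCommMonoid M] [Module K M] {A B : S K →ₗ[K] M}
    (hx : ∀ n, A (divPow K n) = B (divPow K n)) (hy : ∀ n, A (divPowF K n) = B (divPowF K n)) :
    A = B := by
  refine Finsupp.lhom_ext' fun m => LinearMap.ext_ring ?_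
  cases m with
  | pow n => simp [single_pow, hx]
  | powF n => simp [single_powF, hy]

end CharZero

/-! ### Coproduct and coderivations on divided powers -/

theorem coprod_single (m : Mono) :
    coprod K (Finsupp.single m 1) = ((unshuffles m.word).map fun t =>
      t.1 • (wordProd K t.2.1 ⊗ₜ[K] wordProd K t.2.2)).sum := by
  rw [coprod, Finsupp.lift_apply, Finsupp.sum_single_index (by simp), one_smul]

theorem coder_single (φ : S K →ₗ[K] W K) (m : Mono) :
    coder φ (Finsupp.single m 1) = ((unshuffles m.word).map fun t =>
      t.1 • Finsupp.lift (S K) K Gen (fun a => wordProd K (a :: t.2.2))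
        (φ (wordProd K t.2.1))).sum := by
  rw [coder, Finsupp.lift_apply, Finsupp.sum_single_index (by simp), one_smul]

theorem wordProd_cons (a b : Gen) (w : List Gen) :
    wordProd K (a :: b :: w) = Finsupp.lift (S K) K Mono (genMul K a) (wordProd K (b :: w)) := by
  cases a <;> rfl

theorem wordProd_replicate_succ (n : ℕ) :
    wordProd K (List.replicate (n + 1) Gen.e) = Finsupp.single (Mono.pow n) 1 := by
  induction n with
  | zero => rfl
  | succ n ih =>
    rw [List.replicate_succ, List.replicate_succ, wordProd_cons, ← List.replicate_succ, ih]
    simp [genMul]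

theorem wordProd_replicate_append (n : ℕ) :
    wordProd K (List.replicate n Gen.e ++ [Gen.f]) = Finsupp.single (Mono.powF n) 1 := by
  induction n with
  | zero => rfl
  | succ n ih =>
    cases n with
    | zero => simp [wordProd, genMul]
    | succ n =>
      rw [List.replicate_succ, List.cons_append, List.replicate_succ, List.cons_append,
        wordProd_cons, ← List.cons_append, ← List.replicate_succ, ih]
      simp [genMul]

theorem wordProd_f_replicate (n : ℕ) :
    wordProd K (Gen.f :: List.replicate n Gen.e) = Finsupp.single (Mono.powF n) 1 := by
  cases n with
  | zero => rfl
  | succ n =>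
    rw [List.replicate_succ, wordProd_cons, ← List.replicate_succ, wordProd_replicate_succ]
    simp [genMul]

theorem wordProd_f_replicate_append (n : ℕ) :
    wordProd K (Gen.f :: (List.replicate n Gen.e ++ [Gen.f])) = 0 := by
  cases n with
  | zero => simp [wordProd, genMul]
  | succ n =>
    rw [List.replicate_succ, List.cons_append, wordProd_cons, ← List.cons_append,
      ← List.replicate_succ, wordProd_replicate_append]
    simp [genMul]

theorem choose_mul_factorial_mul_factorial_cast {n : ℕ} {p : ℕ × ℕ} (hp : p ∈ antidiagonal n) :
    (n.choose p.1 : K) * (p.1.factorial * p.2.factorial) = n.factorial := by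
  have h := Finset.HasAntidiagonal.mem_antidiagonal.1 hp
  have h' := Nat.choose_mul_factorial_mul_factorial (n := n) (k := p.1) (by omega)
  rw [show n - p.1 = p.2 by omega] at h'
  rw [← h']
  push_cast
  ring

variable [CharZero K]

theorem wordProd_replicate (n : ℕ) :
    wordProd K (List.replicate n Gen.e) = (n.factorial : K) • divPow K n := by
  cases n with
  | zero => simp [wordProd, divPow]
  | succ n => rw [wordProd_replicate_succ, single_pow]

/-- The factorials absorb the binomial coefficients. The convention `divPow K 0 = 0` matches the
empty word going to `0`, so the sum may run over the full antidiagonal. -/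
theorem coprod_divPow (n : ℕ) :
    coprod K (divPow K n) = ∑ p ∈ antidiagonal n, divPow K p.1 ⊗ₜ[K] divPow K p.2 := by
  cases n with
  | zero => simp [divPow]
  | succ n =>
    have h0 : ((n + 1).factorial : K) ≠ 0 := by exact_mod_cast (n + 1).factorial_ne_zero
    have h : ((n + 1).factorial : K) • coprod K (divPow K (n + 1)) =
        ((n + 1).factorial : K) •
          ∑ p ∈ antidiagonal (n + 1), divPow K p.1 ⊗ₜ[K] divPow K p.2 := by
      rw [← map_smul, ← single_pow]
      simp only [coprod_single, one_smul,
        Mono.word, sum_unshuffles_replicate, wordProd_replicate, Finset.smul_sum]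
      refine Finset.sum_congr rfl fun p hp => ?_
      rw [TensorProduct.smul_tmul_smul, ← Nat.cast_smul_eq_nsmul K, smul_smul,
        choose_mul_factorial_mul_factorial_cast hp]
    exact smul_right_injective _ h0 h

theorem coprod_divPowF (n : ℕ) :
    coprod K (divPowF K n) = ∑ p ∈ antidiagonal n,
      (divPowF K p.1 ⊗ₜ[K] divPow K p.2 + divPow K p.1 ⊗ₜ[K] divPowF K p.2) := by
  have h0 : (n.factorial : K) ≠ 0 := by exact_mod_cast n.factorial_ne_zero
  have h : (n.factorial : K) • coprod K (divPowF K n) =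
      (n.factorial : K) • ∑ p ∈ antidiagonal n,
      (divPowF K p.1 ⊗ₜ[K] divPow K p.2 + divPow K p.1 ⊗ₜ[K] divPowF K p.2) := by
    rw [← map_smul, ← single_powF]
    simp only [coprod_single, one_smul,
      Mono.word, sum_unshuffles_replicate_append, wordProd_replicate, wordProd_replicate_append]
    simp only [single_powF, Finset.smul_sum]
    refine Finset.sum_congr rfl fun p hp => ?_
    rw [TensorProduct.smul_tmul_smul, TensorProduct.smul_tmul_smul, ← smul_add,
      ← Nat.cast_smul_eq_nsmul K, smul_smul, choose_mul_factorial_mul_factorial_cast hp]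
  exact smul_right_injective _ h0 h

theorem lift_wordProd_replicate (w : W K) (n : ℕ) :
    Finsupp.lift (S K) K Gen (fun a => wordProd K (a :: List.replicate n Gen.e)) w =
      (n.factorial : K) • (w Gen.e • eDivPow K n + w Gen.f • divPowF K n) := by
  induction w using Finsupp.induction_linear with
  | zero => simp
  | add u v hu hv => rw [map_add, hu, hv, ← smul_add]; simp only [Finsupp.add_apply]; module
  | single a c =>
    cases a with
    | e =>
      simp [← List.replicate_succ, wordProd_replicate_succ, single_pow', smul_smul, mul_comm]
    | f => simp [wordProd_f_replicate, single_powF, smul_smul, mul_comm]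

/-- The `f`-component of `w` contributes nothing because `f f = 0`. -/
theorem lift_wordProd_replicate_append (w : W K) (n : ℕ) :
    Finsupp.lift (S K) K Gen (fun a => wordProd K (a :: (List.replicate n Gen.e ++ [Gen.f]))) w =
      (n.factorial : K) • (w Gen.e • ((n : K) + 1) • divPowF K (n + 1)) := by
  induction w using Finsupp.induction_linear with
  | zero => simp
  | add u v hu hv => rw [map_add, hu, hv, ← smul_add]; simp only [Finsupp.add_apply]; module
  | single a c =>
    cases a with
    | e =>
      have h := wordProd_replicate_append (K := K) (n + 1)
      rw [List.replicate_succ, List.cons_append] at h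
      simp [h, single_powF, smul_smul, Nat.factorial_succ]
      congr 1
      ring
    | f => simp [wordProd_f_replicate_append]

theorem coder_divPow (φ : S K →ₗ[K] W K) (n : ℕ) :
    coder φ (divPow K n) = ∑ p ∈ antidiagonal n,
      (φ (divPow K p.1) Gen.e • eDivPow K p.2 + φ (divPow K p.1) Gen.f • divPowF K p.2) := by
  cases n with
  | zero => simp [divPow]
  | succ n =>
    have h0 : ((n + 1).factorial : K) ≠ 0 := by exact_mod_cast (n + 1).factorial_ne_zero
    refine smul_right_injective _ h0 ?_
    beta_reduce
    rw [← map_smul, ← single_pow]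
    simp only [coder_single, one_smul, Mono.word, sum_unshuffles_replicate, wordProd_replicate,
      Finset.smul_sum, lift_wordProd_replicate, map_smul]
    refine Finset.sum_congr rfl fun p hp => ?_
    rw [← Nat.cast_smul_eq_nsmul K, ← choose_mul_factorial_mul_factorial_cast (K := K) hp]
    module

theorem coder_divPowF (φ : S K →ₗ[K] W K) (n : ℕ) :
    coder φ (divPowF K n) = ∑ p ∈ antidiagonal n,
      (φ (divPowF K p.1) Gen.e • eDivPow K p.2 + φ (divPowF K p.1) Gen.f • divPowF K p.2 +
        φ (divPow K p.1) Gen.e • ((p.2 : K) + 1) • divPowF K (p.2 + 1)) := by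
  have h0 : (n.factorial : K) ≠ 0 := by exact_mod_cast n.factorial_ne_zero
  refine smul_right_injective _ h0 ?_
  beta_reduce
  rw [← map_smul, ← single_powF]
  simp only [coder_single, one_smul, Mono.word, sum_unshuffles_replicate_append, wordProd_replicate,
    wordProd_replicate_append]
  simp only [single_powF, Finset.smul_sum, lift_wordProd_replicate, lift_wordProd_replicate_append, map_smul]
  refine Finset.sum_congr rfl fun p hp => ?_
  rw [← Nat.cast_smul_eq_nsmul K, ← choose_mul_factorial_mul_factorial_cast (K := K) hp]
  module

end

/-! ### Power series acting on sequences -/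

section

theorem sum_antidiagonal_assoc {M : Type*} [AddCommMonoid M] (F : ℕ → ℕ → ℕ → M) (n : ℕ) :
    ∑ p ∈ antidiagonal n, ∑ q ∈ antidiagonal p.1, F q.1 q.2 p.2 =
      ∑ p ∈ antidiagonal n, ∑ q ∈ antidiagonal p.2, F p.1 q.1 q.2 := by
  rw [Finset.sum_sigma', Finset.sum_sigma']
  refine Finset.sum_nbij' (fun x => ⟨(x.2.1, x.2.2 + x.1.2), (x.2.2, x.1.2)⟩)
    (fun x => ⟨(x.1.1 + x.2.1, x.2.2), (x.1.1, x.2.1)⟩) ?_ ?_ ?_ ?_ ?_ <;>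
  · rintro ⟨⟨a, b⟩, ⟨c, d⟩⟩ h
    simp only [Finset.mem_sigma, Finset.HasAntidiagonal.mem_antidiagonal] at h
    obtain ⟨rfl, rfl⟩ := h
    simp [add_assoc]

theorem sum_antidiagonal_left_comm {M : Type*} [AddCommMonoid M] (F : ℕ → ℕ → ℕ → M) (n : ℕ) :
    ∑ p ∈ antidiagonal n, ∑ q ∈ antidiagonal p.2, F p.1 q.1 q.2 =
      ∑ p ∈ antidiagonal n, ∑ q ∈ antidiagonal p.2, F q.1 p.1 q.2 := by
  rw [← sum_antidiagonal_assoc, ← sum_antidiagonal_assoc (fun a b c => F b a c)]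
  refine Finset.sum_congr rfl fun p _ => ?_
  exact Finset.sum_nbij' Prod.swap Prod.swap (by simp [add_comm]) (by simp [add_comm])
    (by simp) (by simp) (by simp)

section Conv

variable {K : Type*} [Field K] {M N : Type*} [AddCommMonoid M] [Module K M]
  [AddCommMonoid N] [Module K N]

/-- The action of power series on sequences, `(q z)_n = ∑_{i + j = n} q_i z_j`. -/
noncomputable def conv (q : K⟦X⟧) (z : ℕ → M) (n : ℕ) : M :=
  ∑ p ∈ antidiagonal n, PowerSeries.coeff p.1 q • z p.2

/-- Together with `conv_one`, this makes sequences a `K⟦X⟧`-module. -/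
theorem conv_mul (p q : K⟦X⟧) (z : ℕ → M) : conv (p * q) z = conv p (conv q z) := by
  funext n
  simp only [conv, PowerSeries.coeff_mul, Finset.sum_smul, Finset.smul_sum, smul_smul]
  exact sum_antidiagonal_assoc
    (fun i j k => (PowerSeries.coeff i p * PowerSeries.coeff j q) • z k) n

theorem conv_X_pow (k : ℕ) (z : ℕ → M) (n : ℕ) :
    conv (PowerSeries.X ^ k : K⟦X⟧) z n = if k ≤ n then z (n - k) else 0 := by
  simp only [conv, PowerSeries.coeff_X_pow, ite_smul, one_smul, zero_smul]
  split_ifs with h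
  · rw [Finset.sum_eq_single (k, n - k)]
    · simp
    · rintro ⟨i, j⟩ hp hne
      rw [Finset.HasAntidiagonal.mem_antidiagonal] at hp
      refine if_neg fun h' => hne ?_
      ext <;> simp at * <;> omega
    · intro h'
      exact absurd (by simp; omega) h'
  · refine Finset.sum_eq_zero fun p hp => if_neg ?_
    rw [Finset.HasAntidiagonal.mem_antidiagonal] at hp
    omega

theorem conv_one (z : ℕ → M) : conv (1 : K⟦X⟧) z = z := by
  funext n
  simpa using conv_X_pow (K := K) 0 z n

theorem conv_zero_left (z : ℕ → M) : conv (0 : K⟦X⟧) z = 0 := by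
  funext n
  simp [conv]

theorem conv_zero_right (q : K⟦X⟧) : conv q (0 : ℕ → M) = 0 := by
  funext n
  simp [conv]

theorem conv_add (q : K⟦X⟧) (z w : ℕ → M) : conv q (z + w) = conv q z + conv q w := by
  funext n
  simp [conv, Finset.sum_add_distrib]

theorem map_conv (A : M →ₗ[K] N) (q : K⟦X⟧) (z : ℕ → M) (n : ℕ) :
    A (conv q z n) = conv q (fun i => A (z i)) n := by
  simp [conv]

/-- The convolution product `∑_{i + j = n} z_i ⊗ w_j` of sequences. -/
noncomputable def tensorConv (z : ℕ → M) (w : ℕ → N) (n : ℕ) : M ⊗[K] N :=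
  ∑ p ∈ antidiagonal n, z p.1 ⊗ₜ[K] w p.2

/-- With `tensorConv_conv_right`, the convolution tensor product is `K⟦X⟧`-bilinear. This
bilinearity is what makes the coderivation and automorphism identities formal. -/
theorem tensorConv_conv_left (q : K⟦X⟧) (z : ℕ → M) (w : ℕ → N) :
    tensorConv (K := K) (conv q z) w = conv q (tensorConv z w) := by
  funext n
  simp only [tensorConv, conv, TensorProduct.sum_tmul, ← TensorProduct.smul_tmul',
    Finset.smul_sum]
  exact sum_antidiagonal_assoc (fun i j k => PowerSeries.coeff i q • (z j ⊗ₜ[K] w k)) n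

theorem tensorConv_conv_right (q : K⟦X⟧) (z : ℕ → M) (w : ℕ → N) :
    tensorConv (K := K) z (conv q w) = conv q (tensorConv z w) := by
  funext n
  simp only [tensorConv, conv, TensorProduct.tmul_sum, TensorProduct.tmul_smul, Finset.smul_sum]
  exact sum_antidiagonal_left_comm (fun i j k => PowerSeries.coeff j q • (z i ⊗ₜ[K] w k)) n

theorem map_tensorConv {M' N' : Type*} [AddCommMonoid M'] [Module K M'] [AddCommMonoid N']
    [Module K N'] (A : M →ₗ[K] M') (B : N →ₗ[K] N') (z : ℕ → M) (w : ℕ → N) (n : ℕ) :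
    TensorProduct.map A B (tensorConv z w n) =
      tensorConv (fun i => A (z i)) (fun i => B (w i)) n := by
  simp [tensorConv]

theorem tensorConv_smul_left (c : K) (z : ℕ → M) (w : ℕ → N) :
    tensorConv (K := K) (c • z) w = c • tensorConv z w := by
  funext n
  simp [tensorConv, TensorProduct.smul_tmul', Finset.smul_sum]

end Conv

variable {K : Type*} [Field K]

/-! ### Coderivations attached to a pair of power series -/

theorem coprod_divPow_eq [CharZero K] (n : ℕ) :
    coprod K (divPow K n) = tensorConv (divPow K) (divPow K) n :=
  coprod_divPow n

theorem coprod_divPowF_eq [CharZero K] (n : ℕ) :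
    coprod K (divPowF K n) =
      (tensorConv (divPowF K) (divPow K) + tensorConv (divPow K) (divPowF K) :
        ℕ → S K ⊗[K] S K) n := by
  rw [coprod_divPowF, Finset.sum_add_distrib]
  rfl

/-- Leibniz rule: `eDivPow` is the derivative of the generating series of `divPow`, and the weight
`n + 1` splits as `p.1 + p.2`. -/
theorem coprod_eDivPow [CharZero K] (n : ℕ) :
    coprod K (eDivPow K n) =
      (tensorConv (eDivPow K) (divPow K) + tensorConv (divPow K) (eDivPow K) :
        ℕ → S K ⊗[K] S K) n := by
  have h1 : tensorConv (K := K) (eDivPow K) (divPow K) n =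
      ∑ p ∈ antidiagonal (n + 1), (p.1 : K) • (divPow K p.1 ⊗ₜ[K] divPow K p.2) := by
    -- The extra boundary term of the longer antidiagonal has weight zero.
    rw [Finset.Nat.sum_antidiagonal_succ]
    simp [tensorConv, eDivPow_eq, TensorProduct.smul_tmul']
  have h2 : tensorConv (K := K) (divPow K) (eDivPow K) n =
      ∑ p ∈ antidiagonal (n + 1), (p.2 : K) • (divPow K p.1 ⊗ₜ[K] divPow K p.2) := by
    rw [Finset.Nat.sum_antidiagonal_succ']
    simp [tensorConv, eDivPow_eq, TensorProduct.tmul_smul]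
  rw [Pi.add_apply, h1, h2, eDivPow_eq, map_smul, coprod_divPow, Finset.smul_sum,
    ← Finset.sum_add_distrib]
  refine Finset.sum_congr rfl fun p hp => ?_
  rw [← add_smul]
  congr 1
  rw [Finset.HasAntidiagonal.mem_antidiagonal] at hp
  exact_mod_cast hp.symm

/-- The endomorphism of `S(W)` corresponding to `r(t) θ ∂_t + s(t) ∂_θ` on the dual algebra. -/
def ActsBy (d : S K →ₗ[K] S K) (r s : K⟦X⟧) : Prop :=
  (∀ n, d (divPow K n) = conv s (divPowF K) n) ∧ ∀ n, d (divPowF K n) = conv r (eDivPow K) n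

theorem ActsBy.ext [CharZero K] {d d' : S K →ₗ[K] S K} {r s : K⟦X⟧} (h : ActsBy d r s) (h' : ActsBy d' r s) :
    d = d' :=
  hom_ext (fun n => (h.1 n).trans (h'.1 n).symm) fun n => (h.2 n).trans (h'.2 n).symm

/-- Since `divPow K 0 = 0`, its image `s(0) f` must vanish; this reflects the absence of a
degree-zero part in the reduced coalgebra. -/
theorem ActsBy.constantCoeff_eq_zero {d : S K →ₗ[K] S K} {r s : K⟦X⟧} (h : ActsBy d r s) :
    PowerSeries.constantCoeff s = 0 := by
  have h0 := congrArg (fun z : S K => z (Mono.powF 0)) (h.1 0)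
  simpa [conv, divPow, divPowF] using h0.symm

theorem ActsBy.apply_eDivPow [CharZero K] {d : S K →ₗ[K] S K} {r s : K⟦X⟧} (h : ActsBy d r s) (n : ℕ) :
    d (eDivPow K n) = ((n : K) + 1) • conv s (divPowF K) (n + 1) := by
  rw [eDivPow_eq, map_smul, h.1]

theorem divPow_apply_powF (n m : ℕ) : divPow K n (Mono.powF m) = 0 := by
  cases n <;> simp [divPow]

theorem hasParity_iff [CharZero K] (p : ZMod 2) (T : S K →ₗ[K] S K) :
    HasParity p T ↔ (∀ n m, m.parity ≠ p → T (divPow K n) m = 0) ∧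
      ∀ n m, m.parity ≠ 1 + p → T (divPowF K n) m = 0 := by
  constructor
  · intro h
    refine ⟨fun n m hm => ?_, fun n m hm => ?_⟩
    · cases n with
      | zero => simp [divPow]
      | succ n =>
        by_contra h'
        refine hm ?_
        rw [h (Mono.pow n) m, Mono.parity, zero_add]
        rw [single_pow, map_smul, Finsupp.smul_apply, smul_eq_mul]
        exact mul_ne_zero (by exact_mod_cast (n + 1).factorial_ne_zero) h'
    · by_contra h'
      refine hm ?_
      rw [h (Mono.powF n) m, Mono.parity]
      rw [single_powF, map_smul, Finsupp.smul_apply, smul_eq_mul]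
      exact mul_ne_zero (by exact_mod_cast n.factorial_ne_zero) h'
  · rintro ⟨h1, h2⟩ m m' hm
    by_contra hne
    apply hm
    cases m with
    | pow n =>
      rw [single_pow, map_smul, Finsupp.smul_apply, h1 _ _ (by simpa [Mono.parity] using hne),
        smul_zero]
    | powF n =>
      rw [single_powF, map_smul, Finsupp.smul_apply, h2 _ _ (by simpa [Mono.parity] using hne),
        smul_zero]

theorem conv_divPowF_apply_pow (s : K⟦X⟧) (n m : ℕ) : conv s (divPowF K) n (Mono.pow m) = 0 := by
  simp [conv, divPowF, Finsupp.finsetSum_apply]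

theorem conv_eDivPow_apply_powF (r : K⟦X⟧) (n m : ℕ) :
    conv r (eDivPow K) n (Mono.powF m) = 0 := by
  simp [conv, eDivPow, Finsupp.finsetSum_apply]

theorem ActsBy.hasParity [CharZero K] {d : S K →ₗ[K] S K} {r s : K⟦X⟧} (h : ActsBy d r s) :
    HasParity 1 d := by
  rw [hasParity_iff]
  refine ⟨fun n m hm => ?_, fun n m hm => ?_⟩
  · rw [h.1]
    cases m with
    | pow m => exact conv_divPowF_apply_pow ..
    | powF m => exact absurd rfl hm
  · rw [h.2]
    cases m with
    | pow m => exact absurd (by simp [Mono.parity]; decide) hm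
    | powF m => exact conv_eDivPow_apply_powF ..

theorem gradingInv_divPow (n : ℕ) : gradingInv K (divPow K n) = divPow K n := by
  cases n <;> simp [gradingInv, divPow, Mono.parity, koszul]

theorem gradingInv_divPowF (n : ℕ) : gradingInv K (divPowF K n) = (-1 : K) • divPowF K n := by
  simp [gradingInv, divPowF, Mono.parity, koszul]

theorem ActsBy.isOddCoderivation [CharZero K] {d : S K →ₗ[K] S K} {r s : K⟦X⟧} (h : ActsBy d r s) :
    IsOddCoderivation d := by
  have hx : (fun n => d (divPow K n)) = conv s (divPowF K) := funext h.1
  have hy : (fun n => d (divPowF K n)) = conv r (eDivPow K) := funext h.2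
  have gx : (fun n => gradingInv K (divPow K n)) = divPow K := funext gradingInv_divPow
  have gy : (fun n => gradingInv K (divPowF K n)) = (-1 : K) • divPowF K := funext gradingInv_divPowF
  refine ⟨h.hasParity, hom_ext (fun n => ?_) fun n => ?_⟩
  · simp only [LinearMap.comp_apply, LinearMap.add_apply]
    rw [h.1, map_conv, funext coprod_divPowF_eq, coprod_divPow_eq, map_tensorConv, map_tensorConv,
      hx, gx]
    simp only [LinearMap.id_apply]
    rw [tensorConv_conv_left, tensorConv_conv_right, conv_add, Pi.add_apply]
  · simp only [LinearMap.comp_apply, LinearMap.add_apply]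
    rw [h.2, map_conv, funext coprod_eDivPow, coprod_divPowF_eq, Pi.add_apply, map_add, map_add,
      map_tensorConv, map_tensorConv, map_tensorConv, map_tensorConv, hx, hy, gx, gy]
    simp only [LinearMap.id_apply]
    rw [tensorConv_smul_left, tensorConv_conv_left, tensorConv_conv_left, tensorConv_conv_right,
      tensorConv_conv_right, conv_add, Pi.add_apply, Pi.smul_apply,
      add_assoc, ← add_assoc (conv s _ n)]
    -- The two terms with `f` in both tensor factors carry opposite Koszul signs and cancel.
    have hz (z : S K ⊗[K] S K) : z + (-1 : K) • z = 0 := by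
      have h := add_smul (1 : K) (-1) z
      rwa [one_smul, add_neg_cancel, zero_smul, eq_comm] at h
    rw [hz, zero_add]

/-- The image of `d` is even, and `d` kills the even part. -/
theorem ActsBy.comp_self_left [CharZero K] {d : S K →ₗ[K] S K} {r : K⟦X⟧} (h : ActsBy d r 0) :
    d ∘ₗ d = 0 := by
  refine hom_ext (fun n => ?_) fun n => ?_
  · simp [h.1, conv_zero_left]
  · simp only [LinearMap.comp_apply, h.2, map_conv, h.apply_eDivPow, conv_zero_left,
      Pi.zero_apply, smul_zero, LinearMap.zero_apply]
    exact congrFun (conv_zero_right r) n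

/-- The image of `d` is odd, and `d` kills the odd part. -/
theorem ActsBy.comp_self_right [CharZero K] {d : S K →ₗ[K] S K} {s : K⟦X⟧} (h : ActsBy d 0 s) :
    d ∘ₗ d = 0 := by
  refine hom_ext (fun n => ?_) fun n => ?_
  · simp only [LinearMap.comp_apply, h.1, map_conv, h.2, conv_zero_left, LinearMap.zero_apply]
    exact congrFun (conv_zero_right s) n
  · simp [h.2, conv_zero_left]

theorem conv_divPowF_apply_powF_zero (s : K⟦X⟧) (n : ℕ) :
    conv s (divPowF K) n (Mono.powF 0) = PowerSeries.coeff n s := by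
  simp only [conv, Finsupp.finsetSum_apply, Finsupp.smul_apply, divPowF]
  rw [Finset.sum_eq_single (n, 0)]
  · simp
  · rintro ⟨i, j⟩ hp hne
    rw [Finset.HasAntidiagonal.mem_antidiagonal] at hp
    have : j ≠ 0 := by
      rintro rfl
      exact hne (by simpa using hp)
    simp [this]
  · simp

theorem conv_eDivPow_apply_pow_zero (r : K⟦X⟧) (n : ℕ) :
    conv r (eDivPow K) n (Mono.pow 0) = PowerSeries.coeff n r := by
  simp only [conv, Finsupp.finsetSum_apply, Finsupp.smul_apply, eDivPow]
  rw [Finset.sum_eq_single (n, 0)]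
  · simp
  · rintro ⟨i, j⟩ hp hne
    rw [Finset.HasAntidiagonal.mem_antidiagonal] at hp
    have : j ≠ 0 := by
      rintro rfl
      exact hne (by simpa using hp)
    simp [this]
  · simp

/-- Applying `d` twice to `divPow` gives `s r` acting on `eDivPow`; the coefficient of `e` reads off
`s r`, and `K⟦X⟧` is a domain. -/
theorem ActsBy.eq_zero_or_eq_zero {d : S K →ₗ[K] S K} {r s : K⟦X⟧} (h : ActsBy d r s)
    (hd : d ∘ₗ d = 0) : r = 0 ∨ s = 0 := by
  have h2 : s * r = 0 := by
    ext n
    have := LinearMap.congr_fun hd (divPow K n)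
    rw [LinearMap.comp_apply, h.1, map_conv, funext h.2, ← conv_mul] at this
    rw [← conv_eDivPow_apply_pow_zero, this]
    simp
  exact (mul_eq_zero.1 h2).symm

/-- Contraction of `S(W) ⊗ S(W)` with the coefficient of `e` in the first factor. -/
noncomputable def contract (K : Type*) [Field K] : S K ⊗[K] S K →ₗ[K] S K :=
  TensorProduct.lift (LinearMap.toSpanSingleton K (S K →ₗ[K] S K) LinearMap.id ∘ₗ
    Finsupp.lapply (Mono.pow 0))

theorem contract_tmul (u v : S K) : contract K (u ⊗ₜ[K] v) = u (Mono.pow 0) • v := by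
  simp [contract]

end

/-! ### Every odd coderivation comes from a pair of power series -/

section

variable {K : Type*} [Field K]

theorem divPow_apply_pow_zero (n : ℕ) :
    divPow K n (Mono.pow 0) = PowerSeries.coeff n (PowerSeries.X : K⟦X⟧) := by
  rcases n with _ | _ | n <;> simp [divPow, PowerSeries.coeff_X]

theorem contract_tensorConv (z w : ℕ → S K) (n : ℕ) :
    contract K (tensorConv z w n) =
      conv (PowerSeries.mk fun i => z i (Mono.pow 0)) w n := by
  simp [tensorConv, conv, contract_tmul]

theorem contract_tensorConv_divPow (w : ℕ → S K) (n : ℕ) :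
    contract K (tensorConv (divPow K) w n) = conv (PowerSeries.X : K⟦X⟧) w n := by
  rw [contract_tensorConv]
  congr 1
  ext i
  rw [PowerSeries.coeff_mk, divPow_apply_pow_zero]

theorem contract_tensorConv_divPowF (w : ℕ → S K) (n : ℕ) :
    contract K (tensorConv (divPowF K) w n) = 0 := by
  rw [contract_tensorConv]
  have : (PowerSeries.mk fun i => divPowF K i (Mono.pow 0)) = 0 := by
    ext i
    simp [divPowF]
  rw [this, conv_zero_left, Pi.zero_apply]

theorem conv_X_zero {M : Type*} [AddCommMonoid M] [Module K M] (z : ℕ → M) :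
    conv (PowerSeries.X : K⟦X⟧) z 0 = 0 := by
  simpa using conv_X_pow (K := K) 1 z 0

theorem conv_X_succ {M : Type*} [AddCommMonoid M] [Module K M] (z : ℕ → M) (n : ℕ) :
    conv (PowerSeries.X : K⟦X⟧) z (n + 1) = z n := by
  simpa using conv_X_pow (K := K) 1 z (n + 1)

/-- The coderivation dual to the multiplication by the coordinate dual to `e`. -/
noncomputable def shift (K : Type*) [Field K] : S K →ₗ[K] S K := contract K ∘ₗ coprod K

theorem shift_divPow [CharZero K] (n : ℕ) :
    shift K (divPow K n) = conv (PowerSeries.X : K⟦X⟧) (divPow K) n := by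
  rw [shift, LinearMap.comp_apply, coprod_divPow_eq, contract_tensorConv_divPow]

theorem shift_divPowF [CharZero K] (n : ℕ) :
    shift K (divPowF K n) = conv (PowerSeries.X : K⟦X⟧) (divPowF K) n := by
  rw [shift, LinearMap.comp_apply, coprod_divPowF_eq, Pi.add_apply, map_add,
    contract_tensorConv_divPow, contract_tensorConv_divPowF, zero_add]

theorem shift_apply_pow [CharZero K] (z : S K) (n : ℕ) :
    shift K z (Mono.pow n) = ((n : K) + 2) * z (Mono.pow (n + 1)) := by
  have h : Finsupp.lapply (Mono.pow n) ∘ₗ shift K =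
      ((n : K) + 2) • Finsupp.lapply (Mono.pow (n + 1)) := by
    refine hom_ext (fun k => ?_) fun k => ?_
    · rcases k with _ | _ | k
      · simp [divPow]
      · rw [LinearMap.comp_apply, shift_divPow, conv_X_succ]
        simp [divPow]
      · by_cases hk : k = n
        · subst hk
          have h1 : ((k + 1).factorial : K) ≠ 0 := by exact_mod_cast (k + 1).factorial_ne_zero
          have h2 : ((k : K) + 2) ≠ 0 := by exact_mod_cast (k + 1).succ_ne_zero
          rw [LinearMap.comp_apply, shift_divPow, conv_X_succ]
          simp [divPow, Nat.factorial_succ (k + 1)]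
          rw [show (k : K) + 1 + 1 = k + 2 by ring]
          field_simp
        · rw [LinearMap.comp_apply, shift_divPow, conv_X_succ]
          simp [divPow, hk]
    · rcases k with _ | k
      · rw [LinearMap.comp_apply, shift_divPowF, conv_X_zero]
        simp [divPowF]
      · rw [LinearMap.comp_apply, shift_divPowF, conv_X_succ]
        simp [divPowF]
  exact LinearMap.congr_fun h z

theorem shift_apply_powF [CharZero K] (z : S K) (n : ℕ) :
    shift K z (Mono.powF n) = ((n : K) + 1) * z (Mono.powF (n + 1)) := by
  have h : Finsupp.lapply (Mono.powF n) ∘ₗ shift K =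
      ((n : K) + 1) • Finsupp.lapply (Mono.powF (n + 1)) := by
    refine hom_ext (fun k => ?_) fun k => ?_
    · rcases k with _ | k
      · simp [divPow]
      · rw [LinearMap.comp_apply, shift_divPow, conv_X_succ]
        simp [divPow_apply_powF]
    · rcases k with _ | k
      · rw [LinearMap.comp_apply, shift_divPowF, conv_X_zero]
        simp [divPowF]
      · by_cases hk : k = n
        · subst hk
          have h1 : (k.factorial : K) ≠ 0 := by exact_mod_cast k.factorial_ne_zero
          have h2 : ((k : K) + 1) ≠ 0 := by exact_mod_cast k.succ_ne_zero
          rw [LinearMap.comp_apply, shift_divPowF, conv_X_succ]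
          simp [divPowF, Nat.factorial_succ k]
          field_simp
        · rw [LinearMap.comp_apply, shift_divPowF, conv_X_succ]
          simp [divPowF, hk]
  exact LinearMap.congr_fun h z

/-- The kernel of `shift` is `W`: the factors `n + 2` and `n + 1` in its coefficients are invertible
in characteristic zero. -/
theorem eq_of_shift_eq [CharZero K] {z w : S K} (h : shift K z = shift K w)
    (hx : z (Mono.pow 0) = w (Mono.pow 0)) (hy : z (Mono.powF 0) = w (Mono.powF 0)) : z = w := by
  ext m
  rcases m with (_ | n) | (_ | n)
  · exact hx
  · have h1 : ((n : K) + 2) ≠ 0 := by exact_mod_cast (n + 1).succ_ne_zero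
    have := DFunLike.congr_fun h (Mono.pow n)
    rw [shift_apply_pow, shift_apply_pow] at this
    exact mul_left_cancel₀ h1 this
  · exact hy
  · have h1 : ((n : K) + 1) ≠ 0 := by exact_mod_cast n.succ_ne_zero
    have := DFunLike.congr_fun h (Mono.powF n)
    rw [shift_apply_powF, shift_apply_powF] at this
    exact mul_left_cancel₀ h1 this

/-- The contraction sees only the even element `e` in the first factor, so the Koszul sign is
invisible. -/
theorem contract_map_gradingInv [CharZero K] (d : S K →ₗ[K] S K) (t : S K ⊗[K] S K) :
    contract K (TensorProduct.map (gradingInv K) d t) = d (contract K t) := by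
  have hJ : Finsupp.lapply (Mono.pow 0) ∘ₗ gradingInv K = Finsupp.lapply (Mono.pow 0) := by
    refine hom_ext (fun k => ?_) fun k => ?_
    · simp [gradingInv_divPow]
    · rw [LinearMap.comp_apply, gradingInv_divPowF]
      simp [divPowF]
  have h : contract K ∘ₗ TensorProduct.map (gradingInv K) d = d ∘ₗ contract K := by
    refine TensorProduct.ext' fun u v => ?_
    have := LinearMap.congr_fun hJ u
    simp only [LinearMap.comp_apply, Finsupp.lapply_apply] at this
    simp [contract_tmul, this]
  exact LinearMap.congr_fun h t

/-- Dual of the Leibniz rule for the product of `t` with a function. -/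
theorem IsOddCoderivation.shift_apply [CharZero K] {d : S K →ₗ[K] S K}
    (h : IsOddCoderivation d) (z : S K) :
    shift K (d z) = contract K (TensorProduct.map d LinearMap.id (coprod K z)) +
      d (shift K z) := by
  have := congrArg (contract K) (LinearMap.congr_fun h.2 z)
  simp only [LinearMap.comp_apply, LinearMap.add_apply, map_add, contract_map_gradingInv] at this
  exact this

theorem conv_apply_shift [CharZero K] (r : K⟦X⟧) (n : ℕ) :
    shift K (conv r (eDivPow K) n) =
      conv r (divPow K) n + conv (PowerSeries.X * r) (eDivPow K) n := by
  have hz : (fun i => shift K (eDivPow K i)) =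
      divPow K + conv (PowerSeries.X : K⟦X⟧) (eDivPow K) := by
    funext i
    rcases i with _ | i
    · simp [eDivPow_eq, shift_divPow, conv_X_zero, conv_X_succ, divPow_zero]
    · rw [eDivPow_eq, map_smul, shift_divPow, conv_X_succ, Pi.add_apply, conv_X_succ, eDivPow_eq]
      push_cast
      module
  rw [map_conv, hz, conv_add, Pi.add_apply, mul_comm, conv_mul]

/-- Induction on `n`: both sides have the same `W`-component by the choice of `r` and `s`, and the
same shift by the Leibniz rule and the previous case. -/
theorem IsOddCoderivation.exists_actsBy [CharZero K] {d : S K →ₗ[K] S K}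
    (h : IsOddCoderivation d) : ∃ r s : K⟦X⟧, ActsBy d r s := by
  obtain ⟨hx, hy⟩ := (hasParity_iff _ _).1 h.1
  have hx0 (n : ℕ) : d (divPow K n) (Mono.pow 0) = 0 := hx n _ (by simp [Mono.parity])
  have hy0 (n : ℕ) : d (divPowF K n) (Mono.powF 0) = 0 := hy n _ (by decide)
  set r : K⟦X⟧ := PowerSeries.mk fun n => d (divPowF K n) (Mono.pow 0) with hr
  set s : K⟦X⟧ := PowerSeries.mk fun n => d (divPow K n) (Mono.powF 0) with hs
  -- Oddness of `d` removes the contraction of every term in which `d` hits `e^n/n!`.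
  have hzero : (PowerSeries.mk fun n => d (divPow K n) (Mono.pow 0)) = 0 := by
    ext n
    simp [hx0]
  have hX (n : ℕ) : shift K (d (divPow K n)) = d (shift K (divPow K n)) := by
    rw [h.shift_apply, coprod_divPow_eq, map_tensorConv, contract_tensorConv, hzero,
      conv_zero_left, Pi.zero_apply, zero_add]
  have hY (n : ℕ) :
      shift K (d (divPowF K n)) = conv r (divPow K) n + d (shift K (divPowF K n)) := by
    rw [h.shift_apply, coprod_divPowF_eq, Pi.add_apply, map_add, map_add, map_tensorConv,
      map_tensorConv, contract_tensorConv, contract_tensorConv, hzero, conv_zero_left,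
      Pi.zero_apply, add_zero]
    rfl
  refine ⟨r, s, fun n => ?_, fun n => ?_⟩
  · induction n with
    | zero => simp [divPow, conv, hs]
    | succ n ih =>
      refine eq_of_shift_eq ?_ ?_ ?_
      · rw [hX, shift_divPow, conv_X_succ, ih, map_conv, funext shift_divPowF, ← conv_mul,
          mul_comm, conv_mul, conv_X_succ]
      · rw [hx0, conv_divPowF_apply_pow]
      · rw [conv_divPowF_apply_powF_zero, hs, PowerSeries.coeff_mk]
  · induction n with
    | zero =>
      refine eq_of_shift_eq ?_ ?_ ?_
      · rw [hY, conv_apply_shift, shift_divPowF, conv_X_zero, map_zero, conv_mul, conv_X_zero]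
      · rw [conv_eDivPow_apply_pow_zero, hr, PowerSeries.coeff_mk]
      · rw [hy0, conv_eDivPow_apply_powF]
    | succ n ih =>
      refine eq_of_shift_eq ?_ ?_ ?_
      · rw [hY, conv_apply_shift, shift_divPowF, conv_X_succ, ih, conv_mul, conv_X_succ]
      · rw [conv_eDivPow_apply_pow_zero, hr, PowerSeries.coeff_mk]
      · rw [hy0, conv_eDivPow_apply_powF]

theorem actsBy_coder [CharZero K] {φ : S K →ₗ[K] W K} {r s : K⟦X⟧}
    (hx : ∀ n, φ (divPow K n) = Finsupp.single Gen.f (PowerSeries.coeff n s))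
    (hy : ∀ n, φ (divPowF K n) = Finsupp.single Gen.e (PowerSeries.coeff n r)) :
    ActsBy (coder φ) r s := by
  constructor <;> intro n
  · simp [coder_divPow, hx, conv]
  · simp [coder_divPowF, hx, hy, conv]

/-! ### The series of the model structures and of the two types -/

theorem psiE_divPow (k n : ℕ) : psiE K k (divPow K n) = 0 := by
  cases n <;> simp [psiE, divPow]

theorem psiE_divPowF [CharZero K] (k n : ℕ) :
    psiE K k (divPowF K n) = if n + 1 = k then Finsupp.single Gen.e 1 else 0 := by
  have h1 : (n.factorial : K) ≠ 0 := by exact_mod_cast n.factorial_ne_zero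
  by_cases h : n + 1 = k
  · subst h
    simp [psiE, divPowF, h1]
  · simp [psiE, divPowF, h]

theorem psiF_divPow [CharZero K] (k n : ℕ) (hk : 1 ≤ k) :
    psiF K k (divPow K n) = if n = k then Finsupp.single Gen.f 1 else 0 := by
  cases n with
  | zero => simp [divPow, show ¬ 0 = k by omega]
  | succ n =>
    have h1 : ((n + 1).factorial : K) ≠ 0 := by exact_mod_cast (n + 1).factorial_ne_zero
    by_cases h : n + 1 = k
    · subst h
      simp [psiF, divPow, h1]
    · simp [psiF, divPow, h]

theorem psiF_divPowF (k n : ℕ) : psiF K k (divPowF K n) = 0 := by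
  simp [psiF, divPowF]

/-- The exponent is one less than the degree, since `ψ^{k+1}_e` lives on `e^k f`; for `ψ^k_f`, which
lives on `e^k`, there is no shift. -/
theorem actsBy_psiE [CharZero K] (k : ℕ) :
    ActsBy (coder (psiE K (k + 1))) (PowerSeries.X ^ k) 0 := by
  refine actsBy_coder (fun n => ?_) fun n => ?_
  · simp [psiE_divPow]
  · rw [psiE_divPowF, PowerSeries.coeff_X_pow]
    by_cases h : n = k <;> simp [h]

theorem actsBy_psiF [CharZero K] (k : ℕ) (hk : 1 ≤ k) :
    ActsBy (coder (psiF K k)) 0 (PowerSeries.X ^ k) := by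
  refine actsBy_coder (fun n => ?_) fun n => ?_
  · rw [psiF_divPow _ _ hk, PowerSeries.coeff_X_pow]
    by_cases h : n = k <;> simp [h]
  · simp [psiF_divPowF]

theorem series_single (ψ : ℕ → S K →ₗ[K] W K) (ρ : ℕ → K) (m : Mono) (c : K) :
    series ψ ρ (Finsupp.single m c) = ρ m.degree • ψ m.degree (Finsupp.single m c) := by
  rw [← Finsupp.smul_single_one, map_smul, map_smul, series, Finsupp.lift_apply,
    Finsupp.sum_single_index (by simp), one_smul, smul_comm]

theorem actsBy_series_psiE [CharZero K] (ρ : ℕ → K) :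
    ActsBy (coder (series (psiE K) ρ)) (PowerSeries.mk fun n => ρ (n + 1)) 0 := by
  refine actsBy_coder (fun n => ?_) fun n => ?_
  · cases n with
    | zero => simp [divPow]
    | succ n =>
      rw [divPow, series_single]
      simp [psiE]
  · rw [divPowF, series_single, ← divPowF, psiE_divPowF]
    simp [Mono.degree]

theorem actsBy_series_psiF [CharZero K] (σ : ℕ → K) :
    ActsBy (coder (series (psiF K) σ)) 0 (PowerSeries.X * PowerSeries.mk fun n => σ (n + 1)) := by
  refine actsBy_coder (fun n => ?_) fun n => ?_
  · cases n with
    | zero => simp [divPow]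
    | succ n =>
      rw [divPow, series_single, ← divPow, psiF_divPow _ _ (by simp [Mono.degree])]
      simp [Mono.degree, PowerSeries.coeff_succ_X_mul]
  · rw [divPowF, series_single, ← divPowF, psiF_divPowF]
    simp

theorem ActsBy.coeff_left {d : S K →ₗ[K] S K} {r s : K⟦X⟧} (h : ActsBy d r s) (n : ℕ) :
    PowerSeries.coeff n r = d (divPowF K n) (Mono.pow 0) := by
  rw [h.2, conv_eDivPow_apply_pow_zero]

theorem ActsBy.coeff_right {d : S K →ₗ[K] S K} {r s : K⟦X⟧} (h : ActsBy d r s) (n : ℕ) :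
    PowerSeries.coeff n s = d (divPow K n) (Mono.powF 0) := by
  rw [h.1, conv_divPowF_apply_powF_zero]

theorem ActsBy.eq_zero_iff [CharZero K] {d : S K →ₗ[K] S K} {r s : K⟦X⟧} (h : ActsBy d r s) :
    d = 0 ↔ r = 0 ∧ s = 0 := by
  constructor
  · rintro rfl
    constructor <;> ext n
    · simp [h.coeff_left]
    · simp [h.coeff_right]
  · rintro ⟨rfl, rfl⟩
    exact h.ext ⟨by simp [conv_zero_left], by simp [conv_zero_left]⟩

theorem isEType_iff [CharZero K] {d : S K →ₗ[K] S K} :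
    IsEType d ↔ ∃ r : K⟦X⟧, r ≠ 0 ∧ ActsBy d r 0 := by
  constructor
  · rintro ⟨hd, ρ, rfl⟩
    have h := actsBy_series_psiE (K := K) ρ
    exact ⟨_, fun hr => hd (h.eq_zero_iff.2 ⟨hr, rfl⟩), h⟩
  · rintro ⟨r, hr, h⟩
    refine ⟨fun hd => hr (h.eq_zero_iff.1 hd).1, fun n => PowerSeries.coeff (n - 1) r, ?_⟩
    refine h.ext ?_
    convert actsBy_series_psiE (K := K) fun n => PowerSeries.coeff (n - 1) r
    ext n
    simp

theorem isFType_iff [CharZero K] {d : S K →ₗ[K] S K} :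
    IsFType d ↔ ∃ s : K⟦X⟧, s ≠ 0 ∧ ActsBy d 0 s := by
  constructor
  · rintro ⟨hd, σ, rfl⟩
    have h := actsBy_series_psiF (K := K) σ
    exact ⟨_, fun hs => hd (h.eq_zero_iff.2 ⟨rfl, hs⟩), h⟩
  · rintro ⟨s, hs, h⟩
    refine ⟨fun hd => hs (h.eq_zero_iff.1 hd).2, fun n => PowerSeries.coeff n s, ?_⟩
    refine h.ext ?_
    convert actsBy_series_psiF (K := K) fun n => PowerSeries.coeff n s
    ext n
    cases n with
    -- There is no `ψ^0_f` to carry a constant term, and `s` has none.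
    | zero => simpa using h.constantCoeff_eq_zero
    | succ n => simp [PowerSeries.coeff_succ_X_mul]

end

section

variable {K : Type*} [Field K]

/-! ### Normal forms by rescaling `θ` -/

section Rescale

/-- The endomorphism of `S(W)` dual to the substitution `θ ↦ q(t) θ`. -/
noncomputable def rescale (q : K⟦X⟧) : S K →ₗ[K] S K :=
  Finsupp.lift (S K) K Mono fun m =>
    match m with
    | Mono.pow n => Finsupp.single (Mono.pow n) 1
    | Mono.powF n => (n.factorial : K) • conv q (divPowF K) n

theorem rescale_divPow (q : K⟦X⟧) (n : ℕ) : rescale q (divPow K n) = divPow K n := by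
  cases n <;> simp [rescale, divPow]

theorem rescale_eDivPow (q : K⟦X⟧) (n : ℕ) : rescale q (eDivPow K n) = eDivPow K n := by
  simp [rescale, eDivPow]

variable [CharZero K]

theorem rescale_divPowF (q : K⟦X⟧) (n : ℕ) :
    rescale q (divPowF K n) = conv q (divPowF K) n := by
  have h : (n.factorial : K) ≠ 0 := by exact_mod_cast n.factorial_ne_zero
  simp [rescale, divPowF, smul_smul, h]

theorem rescale_comp (p q : K⟦X⟧) : rescale p ∘ₗ rescale q = rescale (q * p) := by
  refine hom_ext (fun n => ?_) fun n => ?_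
  · simp [rescale_divPow]
  · rw [LinearMap.comp_apply, rescale_divPowF, rescale_divPowF, map_conv, funext (rescale_divPowF p),
      conv_mul]

theorem rescale_one : rescale (1 : K⟦X⟧) = LinearMap.id := by
  refine hom_ext (fun n => ?_) fun n => ?_
  · simp [rescale_divPow]
  · simp [rescale_divPowF, conv_one]

/-- The automorphism of `S(W)` dual to the substitution `θ ↦ u(t) θ`, for a unit `u`. -/
noncomputable def rescaleEquiv (u : K⟦X⟧ˣ) : S K ≃ₗ[K] S K :=
  LinearEquiv.ofLinearMap (rescale (u : K⟦X⟧)) (rescale ((u⁻¹ : K⟦X⟧ˣ) : K⟦X⟧))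
    (by rw [rescale_comp, Units.inv_mul, rescale_one])
    (by rw [rescale_comp, Units.mul_inv, rescale_one])

theorem isCoalgAut_rescaleEquiv (u : K⟦X⟧ˣ) : IsCoalgAut (rescaleEquiv u) := by
  change HasParity 0 (rescale (u : K⟦X⟧)) ∧ coprod K ∘ₗ rescale (u : K⟦X⟧) =
    TensorProduct.map (rescale (u : K⟦X⟧)) (rescale (u : K⟦X⟧)) ∘ₗ coprod K
  refine ⟨(hasParity_iff _ _).2 ⟨fun n m hm => ?_, fun n m hm => ?_⟩,
    hom_ext (fun n => ?_) fun n => ?_⟩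
  · rw [rescale_divPow]
    cases m with
    | pow m => exact absurd rfl hm
    | powF m => exact divPow_apply_powF n m
  · rw [rescale_divPowF]
    cases m with
    | pow m => exact conv_divPowF_apply_pow _ n m
    | powF m => exact absurd rfl hm
  · rw [LinearMap.comp_apply, LinearMap.comp_apply, rescale_divPow, coprod_divPow_eq,
      map_tensorConv, funext (rescale_divPow _)]
  · rw [LinearMap.comp_apply, LinearMap.comp_apply, rescale_divPowF, map_conv,
      funext coprod_divPowF_eq, coprod_divPowF_eq, Pi.add_apply, map_add, map_tensorConv,
      map_tensorConv, funext (rescale_divPow _), funext (rescale_divPowF _),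
      tensorConv_conv_left, tensorConv_conv_right, conv_add, Pi.add_apply]

/-- Rescaling `θ` by `u` multiplies `θ ∂_t` by `u`, and in `ActsBy.conj_right` it multiplies `∂_θ`
by `u⁻¹`. Hence the opposite choices of unit when normalizing the two types. -/
theorem ActsBy.conj_left {d : S K →ₗ[K] S K} {r : K⟦X⟧} (h : ActsBy d r 0) (u : K⟦X⟧ˣ) :
    ActsBy ((rescaleEquiv u).symm.toLinearMap ∘ₗ d ∘ₗ (rescaleEquiv u).toLinearMap) (u * r) 0 := by
  change ActsBy (rescale ((u⁻¹ : K⟦X⟧ˣ) : K⟦X⟧) ∘ₗ d ∘ₗ rescale (u : K⟦X⟧)) (u * r) 0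
  refine ⟨fun n => ?_, fun n => ?_⟩
  · simp [rescale_divPow, h.1, conv_zero_left]
  · rw [LinearMap.comp_apply, LinearMap.comp_apply, rescale_divPowF, map_conv, funext h.2,
      ← conv_mul, map_conv, funext (rescale_eDivPow _)]

theorem ActsBy.conj_right {d : S K →ₗ[K] S K} {s : K⟦X⟧} (h : ActsBy d 0 s) (u : K⟦X⟧ˣ) :
    ActsBy ((rescaleEquiv u).symm.toLinearMap ∘ₗ d ∘ₗ (rescaleEquiv u).toLinearMap) 0
      (s * (u⁻¹ : K⟦X⟧ˣ)) := by
  change ActsBy (rescale ((u⁻¹ : K⟦X⟧ˣ) : K⟦X⟧) ∘ₗ d ∘ₗ rescale (u : K⟦X⟧)) 0 (s * (u⁻¹ : K⟦X⟧ˣ))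
  refine ⟨fun n => ?_, fun n => ?_⟩
  · rw [LinearMap.comp_apply, LinearMap.comp_apply, rescale_divPow, h.1, map_conv,
      funext (rescale_divPowF _), conv_mul]
  · rw [LinearMap.comp_apply, LinearMap.comp_apply, rescale_divPowF, map_conv, funext h.2,
      ← conv_mul, mul_zero, conv_zero_left, Pi.zero_apply, map_zero]

end Rescale

theorem exists_eq_X_pow_mul_unit {r : K⟦X⟧} (hr : r ≠ 0) :
    ∃ (k : ℕ) (u : K⟦X⟧ˣ), r = PowerSeries.X ^ k * (u : K⟦X⟧) :=
  ⟨r.order.toNat, PowerSeries.Unit_of_divided_by_X_pow_order r, by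
    rw [PowerSeries.Unit_of_divided_by_X_pow_order_nonzero hr,
      PowerSeries.X_pow_order_mul_divXPowOrder]⟩

theorem ActsBy.exists_equivalent_psiE [CharZero K] {d : S K →ₗ[K] S K} {r : K⟦X⟧}
    (h : ActsBy d r 0) (hr : r ≠ 0) : ∃ L : ℕ, 1 ≤ L ∧ Equivalent d (coder (psiE K L)) := by
  obtain ⟨k, u, rfl⟩ := exists_eq_X_pow_mul_unit hr
  refine ⟨k + 1, by omega, rescaleEquiv u⁻¹, isCoalgAut_rescaleEquiv _, ?_⟩
  refine (actsBy_psiE k).ext ?_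
  convert h.conj_left u⁻¹ using 1
  rw [mul_left_comm, Units.inv_mul, mul_one]

theorem ActsBy.exists_equivalent_psiF [CharZero K] {d : S K →ₗ[K] S K} {s : K⟦X⟧}
    (h : ActsBy d 0 s) (hs : s ≠ 0) : ∃ L : ℕ, 1 ≤ L ∧ Equivalent d (coder (psiF K L)) := by
  obtain ⟨k, u, rfl⟩ := exists_eq_X_pow_mul_unit hs
  have hk : 1 ≤ k := by
    rw [Nat.one_le_iff_ne_zero]
    rintro rfl
    have h0 := h.constantCoeff_eq_zero
    rw [pow_zero, one_mul] at h0
    exact (u.isUnit.map PowerSeries.constantCoeff).ne_zero h0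
  refine ⟨k, hk, rescaleEquiv u, isCoalgAut_rescaleEquiv _, ?_⟩
  refine (actsBy_psiF k hk).ext ?_
  convert h.conj_right u using 1
  rw [mul_assoc, Units.mul_inv, mul_one]

/-! ### Invariants separating the equivalence classes -/

section Invariants

theorem finrank_supported_image_Iio (F : ℕ → Mono) (hF : Function.Injective F) (k : ℕ) :
    Module.finrank K (Finsupp.supported K K (F '' Set.Iio k)) = k := by
  classical
  rw [(Finsupp.supportedEquivFinsupp (M := K) (R := K) (F '' Set.Iio k)).finrank_eq,
    Module.finrank_finsupp_self, Set.card_image_of_injective _ hF]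
  simp

variable [CharZero K]

theorem gradingInv_apply_pow (z : S K) (m : ℕ) :
    gradingInv K z (Mono.pow m) = z (Mono.pow m) := by
  have h : Finsupp.lapply (Mono.pow m) ∘ₗ gradingInv K = Finsupp.lapply (Mono.pow m) := by
    refine hom_ext (fun n => ?_) fun n => ?_
    · rw [LinearMap.comp_apply, gradingInv_divPow]
    · rw [LinearMap.comp_apply, gradingInv_divPowF]
      simp [divPowF]
  exact LinearMap.congr_fun h z

theorem gradingInv_apply_powF (z : S K) (m : ℕ) :
    gradingInv K z (Mono.powF m) = -z (Mono.powF m) := by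
  have h : Finsupp.lapply (Mono.powF m) ∘ₗ gradingInv K = -Finsupp.lapply (Mono.powF m) := by
    refine hom_ext (fun n => ?_) fun n => ?_
    · rw [LinearMap.comp_apply, gradingInv_divPow]
      simp [divPow_apply_powF]
    · rw [LinearMap.comp_apply, gradingInv_divPowF]
      simp
  exact LinearMap.congr_fun h z

theorem IsCoalgAut.map_gradingInv {g : S K ≃ₗ[K] S K} (hg : IsCoalgAut g) (z : S K) :
    g (gradingInv K z) = gradingInv K (g z) := by
  obtain ⟨hx, hy⟩ := (hasParity_iff _ _).1 hg.1
  have h : g.toLinearMap ∘ₗ gradingInv K = gradingInv K ∘ₗ g.toLinearMap := by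
    refine hom_ext (fun n => ?_) fun n => ?_
    · rw [LinearMap.comp_apply, LinearMap.comp_apply, gradingInv_divPow]
      ext m
      cases m with
      | pow m => rw [gradingInv_apply_pow]
      | powF m => rw [gradingInv_apply_powF, hx n _ (by simp [Mono.parity]), neg_zero]
    · rw [LinearMap.comp_apply, LinearMap.comp_apply, gradingInv_divPowF, map_smul, neg_one_smul]
      ext m
      cases m with
      | pow m =>
        rw [gradingInv_apply_pow, Finsupp.neg_apply, hy n _ (by simp [Mono.parity]), neg_zero]
      | powF m => rw [gradingInv_apply_powF, Finsupp.neg_apply]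
  exact LinearMap.congr_fun h z

theorem ActsBy.comp_gradingInv_left {d : S K →ₗ[K] S K} {r : K⟦X⟧} (h : ActsBy d r 0) :
    d ∘ₗ gradingInv K = -d := by
  refine hom_ext (fun n => ?_) fun n => ?_
  · simp [gradingInv_divPow, h.1, conv_zero_left]
  · simp [gradingInv_divPowF]

theorem ActsBy.comp_gradingInv_right {d : S K →ₗ[K] S K} {s : K⟦X⟧} (h : ActsBy d 0 s) :
    d ∘ₗ gradingInv K = d := by
  refine hom_ext (fun n => ?_) fun n => ?_
  · simp [gradingInv_divPow]
  · simp [gradingInv_divPowF, h.2, conv_zero_left]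

/-- The relation `d J = -d` survives conjugation by `g`, which commutes with `J`; with `d' J = d'`
it gives `d' = -d'`. -/
theorem not_equivalent_of_isEType_of_isFType {d d' : S K →ₗ[K] S K} (hd : IsEType d)
    (hd' : IsFType d') : ¬ Equivalent d d' := by
  rintro ⟨g, hg, hgd⟩
  obtain ⟨r, -, h⟩ := isEType_iff.1 hd
  obtain ⟨s, -, h'⟩ := isFType_iff.1 hd'
  refine hd'.1 (LinearMap.ext fun z => self_eq_neg.1 ?_)
  calc d' z = d' (gradingInv K z) := (LinearMap.congr_fun h'.comp_gradingInv_right z).symm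
    _ = g.symm (d (gradingInv K (g z))) := by rw [← hg.map_gradingInv, hgd]; rfl
    _ = g.symm (-d (g z)) := congrArg g.symm (LinearMap.congr_fun h.comp_gradingInv_left (g z))
    _ = -d' z := by rw [map_neg, hgd]; rfl

/-- The whole kernel is infinite-dimensional for the models, so it is cut down to one parity; `g`
maps one intersection onto the other. -/
theorem Equivalent.finrank_ker_inf_eigenspace {d d' : S K →ₗ[K] S K} (h : Equivalent d d')
    (c : K) :
    Module.finrank K ↥(LinearMap.ker d' ⊓ Module.End.eigenspace (gradingInv K) c) =
      Module.finrank K ↥(LinearMap.ker d ⊓ Module.End.eigenspace (gradingInv K) c) := by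
  obtain ⟨g, hg, rfl⟩ := h
  rw [← LinearEquiv.finrank_map_eq g]
  refine congrArg (fun P : Submodule K (S K) => Module.finrank K P) (Submodule.ext fun z => ?_)
  rw [Submodule.mem_map_equiv]
  simp only [Submodule.mem_inf, LinearMap.mem_ker, Module.End.mem_eigenspace_iff,
    LinearMap.comp_apply, LinearEquiv.coe_coe, LinearEquiv.apply_symm_apply,
    LinearEquiv.map_eq_zero_iff]
  rw [← g.injective.eq_iff (a := gradingInv K _), hg.map_gradingInv, map_smul,
    LinearEquiv.apply_symm_apply]

theorem actsBy_X_pow_left_apply {d : S K →ₗ[K] S K} {k : ℕ}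
    (h : ActsBy d (PowerSeries.X ^ k) 0) (z : S K) (m : ℕ) :
    d z (Mono.pow m) = ((m + k).factorial / m.factorial : K) * z (Mono.powF (m + k)) := by
  have hz : Finsupp.lapply (Mono.pow m) ∘ₗ d =
      ((m + k).factorial / m.factorial : K) • Finsupp.lapply (Mono.powF (m + k)) := by
    refine hom_ext (fun n => ?_) fun n => ?_
    · rw [LinearMap.comp_apply, h.1, conv_zero_left]
      simp [divPow_apply_powF]
    · rw [LinearMap.comp_apply, h.2, conv_X_pow]
      have h1 : (m.factorial : K) ≠ 0 := by exact_mod_cast m.factorial_ne_zero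
      have h2 : ((m + k).factorial : K) ≠ 0 := by exact_mod_cast (m + k).factorial_ne_zero
      by_cases hn : n = m + k
      · subst hn
        simp [eDivPow, divPowF]
        field_simp
      · split_ifs with hk
        · simp [eDivPow, divPowF, hn, show n - k ≠ m by omega]
        · simp [divPowF, hn]
  exact LinearMap.congr_fun hz z

theorem actsBy_X_pow_right_apply {d : S K →ₗ[K] S K} {k : ℕ}
    (h : ActsBy d 0 (PowerSeries.X ^ (k + 1))) (z : S K) (m : ℕ) :
    d z (Mono.powF m) = ((m + k + 1).factorial / m.factorial : K) * z (Mono.pow (m + k)) := by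
  have hz : Finsupp.lapply (Mono.powF m) ∘ₗ d =
      ((m + k + 1).factorial / m.factorial : K) • Finsupp.lapply (Mono.pow (m + k)) := by
    refine hom_ext (fun n => ?_) fun n => ?_
    · rw [LinearMap.comp_apply, h.1, conv_X_pow]
      have h1 : (m.factorial : K) ≠ 0 := by exact_mod_cast m.factorial_ne_zero
      have h2 : ((m + k + 1).factorial : K) ≠ 0 := by
        exact_mod_cast (m + k + 1).factorial_ne_zero
      rcases n with _ | n
      · simp [divPow]
      by_cases hn : n = m + k
      · subst hn
        simp [divPow, divPowF, show m + k + 1 - (k + 1) = m by omega]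
        field_simp
      · split_ifs with hk
        · simp [divPow, divPowF, hn, show n - k ≠ m by omega]
        · simp [divPow, hn]
    · rw [LinearMap.comp_apply, h.2, conv_zero_left]
      simp [divPowF]
  exact LinearMap.congr_fun hz z

/-- On the odd part the kernel is spanned by `e^j f` with `j < k`, since `d` sends `e^{j+k} f` to a
nonzero multiple of `e^{j+1}`. -/
theorem finrank_ker_of_actsBy_X_pow_left {d : S K →ₗ[K] S K} {k : ℕ}
    (h : ActsBy d (PowerSeries.X ^ k) 0) :
    Module.finrank K ↥(LinearMap.ker d ⊓ Module.End.eigenspace (gradingInv K) (-1)) = k := by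
  have hF : Function.Injective Mono.powF := fun a b hab => by simpa using hab
  refine Eq.trans (congrArg (fun P : Submodule K (S K) => Module.finrank K P)
    (Submodule.ext fun z => ?_)) (finrank_supported_image_Iio (K := K) Mono.powF hF k)
  rw [Finsupp.mem_supported', Submodule.mem_inf, LinearMap.mem_ker, Module.End.mem_eigenspace_iff]
  constructor
  · rintro ⟨hd, hJ⟩ m hm
    cases m with
    | pow m =>
      have := DFunLike.congr_fun hJ (Mono.pow m)
      rw [gradingInv_apply_pow, neg_one_smul, Finsupp.neg_apply] at this
      exact self_eq_neg.1 this
    | powF m =>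
      have hkm : k ≤ m := by simpa [hF.eq_iff] using hm
      obtain ⟨j, rfl⟩ := Nat.exists_eq_add_of_le' hkm
      have := actsBy_X_pow_left_apply h z j
      rw [hd, Finsupp.zero_apply, eq_comm, mul_eq_zero, div_eq_zero_iff] at this
      simpa [Nat.factorial_ne_zero] using this
  · intro hz
    constructor
    · ext m
      cases m with
      | pow m => rw [actsBy_X_pow_left_apply h, hz _ (by simp), mul_zero, Finsupp.zero_apply]
      | powF m =>
        have hx : Finsupp.lapply (Mono.powF m) ∘ₗ d = 0 := by
          refine hom_ext (fun n => ?_) fun n => ?_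
          · simp [h.1, conv_zero_left]
          · simp [h.2, conv_eDivPow_apply_powF]
        exact LinearMap.congr_fun hx z
    · ext m
      cases m with
      | pow m => rw [gradingInv_apply_pow, Finsupp.smul_apply, hz _ (by simp), smul_zero]
      | powF m => rw [gradingInv_apply_powF, neg_one_smul, Finsupp.neg_apply]

/-- On the even part the kernel is spanned by `e^{j+1}` with `j < k`. -/
theorem finrank_ker_of_actsBy_X_pow_right {d : S K →ₗ[K] S K} {k : ℕ}
    (h : ActsBy d 0 (PowerSeries.X ^ (k + 1))) :
    Module.finrank K ↥(LinearMap.ker d ⊓ Module.End.eigenspace (gradingInv K) 1) = k := by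
  have hF : Function.Injective Mono.pow := fun a b hab => by simpa using hab
  refine Eq.trans (congrArg (fun P : Submodule K (S K) => Module.finrank K P)
    (Submodule.ext fun z => ?_)) (finrank_supported_image_Iio (K := K) Mono.pow hF k)
  rw [Finsupp.mem_supported', Submodule.mem_inf, LinearMap.mem_ker, Module.End.mem_eigenspace_iff]
  constructor
  · rintro ⟨hd, hJ⟩ m hm
    cases m with
    | powF m =>
      have := DFunLike.congr_fun hJ (Mono.powF m)
      rw [gradingInv_apply_powF, one_smul] at this
      exact self_eq_neg.1 this.symm
    | pow m =>
      have hkm : k ≤ m := by simpa [hF.eq_iff] using hm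
      obtain ⟨j, rfl⟩ := Nat.exists_eq_add_of_le' hkm
      have := actsBy_X_pow_right_apply h z j
      rw [hd, Finsupp.zero_apply, eq_comm, mul_eq_zero, div_eq_zero_iff] at this
      simpa [Nat.factorial_ne_zero] using this
  · intro hz
    constructor
    · ext m
      cases m with
      | powF m => rw [actsBy_X_pow_right_apply h, hz _ (by simp), mul_zero, Finsupp.zero_apply]
      | pow m =>
        have hx : Finsupp.lapply (Mono.pow m) ∘ₗ d = 0 := by
          refine hom_ext (fun n => ?_) fun n => ?_
          · simp [h.1, conv_divPowF_apply_pow]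
          · simp [h.2, conv_zero_left]
        exact LinearMap.congr_fun hx z
    · ext m
      cases m with
      | pow m => rw [gradingInv_apply_pow, one_smul]
      | powF m =>
        rw [gradingInv_apply_powF, Finsupp.smul_apply, hz _ (by simp), smul_zero, neg_zero]

theorem eq_of_equivalent_psiE {k l : ℕ} (hk : 1 ≤ k) (hl : 1 ≤ l)
    (h : Equivalent (coder (psiE K k)) (coder (psiE K l))) : k = l := by
  obtain ⟨k, rfl⟩ := Nat.exists_eq_add_of_le' hk
  obtain ⟨l, rfl⟩ := Nat.exists_eq_add_of_le' hl
  have := h.finrank_ker_inf_eigenspace (-1)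
  rw [finrank_ker_of_actsBy_X_pow_left (actsBy_psiE l),
    finrank_ker_of_actsBy_X_pow_left (actsBy_psiE k)] at this
  rw [this]

theorem eq_of_equivalent_psiF {k l : ℕ} (hk : 1 ≤ k) (hl : 1 ≤ l)
    (h : Equivalent (coder (psiF K k)) (coder (psiF K l))) : k = l := by
  obtain ⟨k, rfl⟩ := Nat.exists_eq_add_of_le' hk
  obtain ⟨l, rfl⟩ := Nat.exists_eq_add_of_le' hl
  have := h.finrank_ker_inf_eigenspace 1
  rw [finrank_ker_of_actsBy_X_pow_right (actsBy_psiF _ hl),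
    finrank_ker_of_actsBy_X_pow_right (actsBy_psiF _ hk)] at this
  rw [this]

end Invariants

end

/-! ### Lie algebra structures -/

section

variable {K : Type*} [Field K]

/-- Projecting a coderivation to `W` recovers `φ`, so a quadratic `φ` cannot present a model of
another degree. -/
theorem coder_divPowF_apply_pow_zero [CharZero K] (φ : S K →ₗ[K] W K) (n : ℕ) :
    coder φ (divPowF K n) (Mono.pow 0) = φ (divPowF K n) Gen.e := by
  rw [coder_divPowF]
  simp only [Finsupp.finsetSum_apply, Finsupp.add_apply, Finsupp.smul_apply, eDivPow, divPowF]
  rw [Finset.sum_eq_single (n, 0)]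
  · simp
  · rintro ⟨i, j⟩ hp hne
    rw [Finset.HasAntidiagonal.mem_antidiagonal] at hp
    have : j ≠ 0 := by
      rintro rfl
      exact hne (by simpa using hp)
    simp [this]
  · simp

theorem coder_divPow_apply_powF_zero [CharZero K] (φ : S K →ₗ[K] W K) (n : ℕ) :
    coder φ (divPow K n) (Mono.powF 0) = φ (divPow K n) Gen.f := by
  rw [coder_divPow]
  simp only [Finsupp.finsetSum_apply, Finsupp.add_apply, Finsupp.smul_apply, eDivPow, divPowF]
  rw [Finset.sum_eq_single (n, 0)]
  · simp
  · rintro ⟨i, j⟩ hp hne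
    rw [Finset.HasAntidiagonal.mem_antidiagonal] at hp
    have : j ≠ 0 := by
      rintro rfl
      exact hne (by simpa using hp)
    simp [this]
  · simp

theorem eq_two_of_isLieStructure_psiE [CharZero K] {L : ℕ} (hL : 1 ≤ L)
    (h : IsLieStructure (coder (psiE K L))) : L = 2 := by
  obtain ⟨φ, hφ, hdeg, -⟩ := h
  obtain ⟨k, rfl⟩ := Nat.exists_eq_add_of_le' hL
  by_contra hk
  have h1 := (actsBy_psiE (K := K) k).coeff_left k
  rw [hφ, coder_divPowF_apply_pow_zero, divPowF, ← Finsupp.smul_single_one, map_smul,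
    hdeg (Mono.powF k) hk] at h1
  simp at h1

theorem eq_two_of_isLieStructure_psiF [CharZero K] {L : ℕ} (hL : 1 ≤ L)
    (h : IsLieStructure (coder (psiF K L))) : L = 2 := by
  obtain ⟨φ, hφ, hdeg, -⟩ := h
  have h1 := (actsBy_psiF (K := K) L hL).coeff_right L
  obtain ⟨k, rfl⟩ := Nat.exists_eq_add_of_le' hL
  by_contra hk
  rw [hφ, coder_divPow_apply_powF_zero, divPow, ← Finsupp.smul_single_one, map_smul,
    hdeg (Mono.pow k) hk] at h1
  simp at h1

theorem mem_revComponent_zero {x : W K} : x ∈ revComponent K 0 ↔ x Gen.e = 0 := by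
  rw [revComponent, Finsupp.mem_supported']
  constructor
  · intro h
    exact h Gen.e (by simp [Gen.revParity, Gen.parity])
  · rintro h (_ | _) ha
    · exact h
    · exact absurd (by simp [Gen.revParity, Gen.parity]; decide) ha

theorem mem_revComponent_one {x : W K} : x ∈ revComponent K 1 ↔ x Gen.f = 0 := by
  rw [revComponent, Finsupp.mem_supported']
  constructor
  · intro h
    exact h Gen.f (by simp [Gen.revParity, Gen.parity])
  · rintro h (_ | _) ha
    · exact absurd (by simp [Gen.revParity, Gen.parity]) ha
    · exact h

theorem W_ext {x y : W K} (he : x Gen.e = y Gen.e) (hf : x Gen.f = y Gen.f) : x = y := by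
  ext a
  cases a
  · exact he
  · exact hf

/-- The bracket on `ΠW` with `[f, e] = e`. -/
noncomputable def bracketE (K : Type*) [Field K] : W K →ₗ[K] W K →ₗ[K] W K :=
  LinearMap.mk₂ K (fun x y => Finsupp.single Gen.e (x Gen.f * y Gen.e - x Gen.e * y Gen.f))
    (fun x x' y => W_ext (by simp; ring) (by simp))
    (fun c x y => W_ext (by simp; ring) (by simp))
    (fun x y y' => W_ext (by simp; ring) (by simp))
    (fun c x y => W_ext (by simp; ring) (by simp))

/-- The bracket on `ΠW` with `[e, e] = -2 f`. -/
noncomputable def bracketF (K : Type*) [Field K] : W K →ₗ[K] W K →ₗ[K] W K :=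
  LinearMap.mk₂ K (fun x y => Finsupp.single Gen.f (-2 * (x Gen.e * y Gen.e)))
    (fun x x' y => W_ext (by simp) (by simp; ring))
    (fun c x y => W_ext (by simp) (by simp; ring))
    (fun x y y' => W_ext (by simp) (by simp; ring))
    (fun c x y => W_ext (by simp) (by simp; ring))

theorem bracketE_apply (x y : W K) : bracketE K x y =
    Finsupp.single Gen.e (x Gen.f * y Gen.e - x Gen.e * y Gen.f) := rfl

theorem bracketF_apply (x y : W K) : bracketF K x y =
    Finsupp.single Gen.f (-2 * (x Gen.e * y Gen.e)) := rfl

theorem zmod_two_cases (p : ZMod 2) : p = 0 ∨ p = 1 := by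
  revert p
  decide

theorem isSuperLieBracket_bracketE : IsSuperLieBracket (bracketE K) := by
  have h11 : (1 : ZMod 2) + 1 = 0 := rfl
  refine ⟨fun p q x hx y hy => ?_, fun p q x hx y hy => ?_, fun p q x hx y hy z => ?_⟩ <;>
  rcases zmod_two_cases p with rfl | rfl <;> rcases zmod_two_cases q with rfl | rfl <;>
  simp only [add_zero, zero_add, h11, mem_revComponent_zero, mem_revComponent_one] at hx hy ⊢
  all_goals first
    | simp [bracketE_apply, hx, hy]; done
    | refine W_ext ?_ ?_ <;> simp [bracketE_apply, hx, hy, koszul]; ring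

/-- All brackets are multiples of `f`, which is central, so every term of the Jacobi identity
vanishes. -/
theorem isSuperLieBracket_bracketF : IsSuperLieBracket (bracketF K) := by
  have h11 : (1 : ZMod 2) + 1 = 0 := rfl
  refine ⟨fun p q x hx y hy => ?_, fun p q x hx y hy => ?_, fun p q x hx y hy z => ?_⟩ <;>
  rcases zmod_two_cases p with rfl | rfl <;> rcases zmod_two_cases q with rfl | rfl <;>
  simp only [add_zero, zero_add, h11, mem_revComponent_zero, mem_revComponent_one] at hx hy ⊢
  all_goals first
    | simp [bracketF_apply, hx, hy]; done
    | refine W_ext ?_ ?_ <;> simp [bracketF_apply, koszul, mul_comm]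

/-- As `e` is odd in `ΠW`, `φ(ef) = e` means `[e, f] = -e`, consistent with `[f, e] = e`. -/
theorem isLieStructure_psiE_two : IsLieStructure (coder (psiE K 2)) := by
  refine ⟨psiE K 2, rfl, fun m hm => ?_, bracketE K, isSuperLieBracket_bracketE, fun a b => ?_⟩
  · cases m with
    | pow n => simp [psiE]
    | powF n =>
      have : ¬ n + 1 = 2 := hm
      simp [psiE]
      omega
  · have h11 : (1 : ZMod 2) + 1 = 0 := rfl
    cases a <;> cases b <;>
      simp [psiE, wordProd, genMul, bracketE_apply, koszul, Gen.revParity, Gen.parity, h11]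

/-- The factor `-2` in the bracket is `2!` from `ψ^2_f(e^2)` times the sign of the odd element `e`
of `ΠW`. -/
theorem isLieStructure_psiF_two : IsLieStructure (coder (psiF K 2)) := by
  refine ⟨psiF K 2, rfl, fun m hm => ?_, bracketF K, isSuperLieBracket_bracketF, fun a b => ?_⟩
  · cases m with
    | powF n => simp [psiF]
    | pow n =>
      have : ¬ n + 1 = 2 := hm
      simp [psiF]
      omega
  · have h11 : (1 : ZMod 2) + 1 = 0 := rfl
    cases a <;> cases b <;>
      simp [psiF, wordProd, genMul, bracketF_apply, koszul, Gen.revParity, Gen.parity, h11]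

end

end SuperPlane

theorem mainTheorem1 (K : Type*) [Field K] [CharZero K] :
    -- `ψ^L_e` and `ψ^L_f` are nonzero `L_∞` structures
    (∀ L : ℕ, 1 ≤ L →
      (SuperPlane.IsLInfty (SuperPlane.coder (SuperPlane.psiE K L)) ∧
        SuperPlane.IsEType (SuperPlane.coder (SuperPlane.psiE K L))) ∧
      (SuperPlane.IsLInfty (SuperPlane.coder (SuperPlane.psiF K L)) ∧
        SuperPlane.IsFType (SuperPlane.coder (SuperPlane.psiF K L)))) ∧
    -- every nonzero structure is of `e`-type or `f`-type, and equivalent to the model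
    (∀ d : SuperPlane.S K →ₗ[K] SuperPlane.S K, SuperPlane.IsLInfty d → d ≠ 0 →
      (SuperPlane.IsEType d ∧
        ∃ L : ℕ, 1 ≤ L ∧ SuperPlane.Equivalent d (SuperPlane.coder (SuperPlane.psiE K L))) ∨
      (SuperPlane.IsFType d ∧
        ∃ L : ℕ, 1 ≤ L ∧ SuperPlane.Equivalent d (SuperPlane.coder (SuperPlane.psiF K L)))) ∧
    -- structures of different types are never equivalent
    (∀ d d' : SuperPlane.S K →ₗ[K] SuperPlane.S K,
      SuperPlane.IsLInfty d → SuperPlane.IsLInfty d' →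
      SuperPlane.IsEType d → SuperPlane.IsFType d' → ¬ SuperPlane.Equivalent d d') ∧
    -- the members of each family are pairwise nonequivalent
    (∀ k l : ℕ, 1 ≤ k → 1 ≤ l → k ≠ l →
      ¬ SuperPlane.Equivalent
        (SuperPlane.coder (SuperPlane.psiE K k)) (SuperPlane.coder (SuperPlane.psiE K l)) ∧
      ¬ SuperPlane.Equivalent
        (SuperPlane.coder (SuperPlane.psiF K k)) (SuperPlane.coder (SuperPlane.psiF K l))) ∧
    -- precisely the two members with `L = 2` are Lie algebra structures
    (∀ L : ℕ, 1 ≤ L →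
      (SuperPlane.IsLieStructure (SuperPlane.coder (SuperPlane.psiE K L)) ↔ L = 2) ∧
      (SuperPlane.IsLieStructure (SuperPlane.coder (SuperPlane.psiF K L)) ↔ L = 2)) := by
  refine ⟨fun L hL => ⟨?_, ?_⟩, fun d hd h0 => ?_,
    fun d d' _ _ h h' => SuperPlane.not_equivalent_of_isEType_of_isFType h h',
    fun k l hk hl hkl => ⟨fun h => hkl (SuperPlane.eq_of_equivalent_psiE hk hl h),
      fun h => hkl (SuperPlane.eq_of_equivalent_psiF hk hl h)⟩,
    fun L hL => ⟨⟨SuperPlane.eq_two_of_isLieStructure_psiE hL, ?_⟩,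
      ⟨SuperPlane.eq_two_of_isLieStructure_psiF hL, ?_⟩⟩⟩
  · obtain ⟨k, rfl⟩ := Nat.exists_eq_add_of_le' hL
    have h := SuperPlane.actsBy_psiE (K := K) k
    exact ⟨⟨h.isOddCoderivation, h.comp_self_left⟩,
      SuperPlane.isEType_iff.2 ⟨_, pow_ne_zero _ PowerSeries.X_ne_zero, h⟩⟩
  · have h := SuperPlane.actsBy_psiF (K := K) L hL
    exact ⟨⟨h.isOddCoderivation, h.comp_self_right⟩,
      SuperPlane.isFType_iff.2 ⟨_, pow_ne_zero _ PowerSeries.X_ne_zero, h⟩⟩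
  · obtain ⟨r, s, h⟩ := hd.1.exists_actsBy
    rcases h.eq_zero_or_eq_zero hd.2 with rfl | rfl
    · have hs : s ≠ 0 := fun hs => h0 (h.eq_zero_iff.2 ⟨rfl, hs⟩)
      exact Or.inr ⟨SuperPlane.isFType_iff.2 ⟨s, hs, h⟩, h.exists_equivalent_psiF hs⟩
    · have hr : r ≠ 0 := fun hr => h0 (h.eq_zero_iff.2 ⟨hr, rfl⟩)
      exact Or.inl ⟨SuperPlane.isEType_iff.2 ⟨r, hr, h⟩, h.exists_equivalent_psiE hr⟩
  · rintro rfl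
    exact SuperPlane.isLieStructure_psiE_two
  · rintro rfl
    exact SuperPlane.isLieStructure_psiF_two
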